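/- **Proposition (Estimation and prediction error).** There are absolute constants $C, c_0, c_1, c_2 > 0$ such that the following holds for all integers $n, p, k \ge 1$. *Setup.* Let $\{X^t\}_{t\in\mathbb Z}$ (with values in $\mathbb R^p$) and $\{\varepsilon^t\}_{t\in\mathbb Z}$ (real-valued) be independent, centered, stationary Gaussian processes on a probability space. For a stationary process $Z$ with $\Gamma_Z(\ell)=\operatorname{Cov}(Z^t,Z^{t+\ell})$, the spectral density is $$f_Z(\theta)=\frac1{2\pi}\sum_{\ell\in\mathbb Z}\Gamma_Z(\ell)e^{-i\ell\theta},\qquad \theta\in[-\pi,\pi]$$ (the series converging in $L^2[-\pi,\pi]$), and we put $$\mathcal M(f_Z)=\operatorname*{ess\,sup}_{\theta\in[-\pi,\pi]}\Lambda_{\max}(f_Z(\theta)),\qquad \mathfrak m(f_Z)=\operatorname*{ess\,inf}_{\theta\in[-\pi,\pi]}\Lambda_{\min}(f_Z(\theta)),$$ where $\Lambda_{\max},\Lambda_{\min}$ denote the largest and smallest eigenvalue. Let $\mathcal M(f_X,k)$ be the maximum of $\mathcal M(f_{X(J)})$ over nonempty $J\subseteq\{1,\dots,p\}$ with $|J|\le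 k$, where $X(J)=(X_j)_{j\in J}$. Assume that $f_X$ and $f_\varepsilon$ exist, that $\mathcal M(f_X)<\infty$ and $\mathcal M(f_\varepsilon)<\infty$, and that $\mathfrak m(f_X)>0$. Let $\beta^*\in\mathbb R^p$ have at most $k$ nonzero entries, and let $$y^t=\langle\beta^*,X^t\rangle+\varepsilon^t,\qquad t=1,\dots,n,\qquad Y=[y^n:\dots:y^1]',\quad \mathcal X=[X^n:\dots:X^1]'.$$ *Claim.* Suppose that $$n\ \ge\ C\left[\frac{\mathcal M(f_X,k)}{\mathfrak m(f_X)}\right]^2k\log p,\qquad \lambda_n\ \ge\ c_0\,2\pi\,[\mathcal M(f_X,1)+\mathcal M(f_\varepsilon)]\sqrt{\frac{\log p}{n}},$$ and put $\alpha_{\mathrm{RE}}=\pi\,\mathfrak m(f_X)$. Then with probability at least $1-c_1\exp(-c_2\log p)$, every minimizer $\hat\beta$ over $\beta\in\mathbb R^p$ of $\frac1n\|Y-\mathcal X\beta\|^2+\lambda_n\|\beta\|_1$ satisfies $$\|\hat\beta-\beta^*\|\le\frac{2\lambda_n\sqrt k}{\alpha_{\mathrm{RE}}},\qquad \|\hat\beta-\beta^*\|_1\le\frac{8\lambda_n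 k}{\alpha_{\mathrm{RE}}},\qquad \frac1n\|\mathcal X(\hat\beta-\beta^*)\|^2\le\frac{4\lambda_n^2k}{\alpha_{\mathrm{RE}}},$$ and its thresholded version $\tilde\beta_j=\hat\beta_j\mathbf 1\{|\hat\beta_j|>\lambda_n\}$, $1\le j\le p$, satisfies $$|\operatorname{supp}(\tilde\beta)\setminus\operatorname{supp}(\beta^*)|\le\frac{24k}{\alpha_{\mathrm{RE}}}.$$ -/

import Mathlib

open MeasureTheory ProbabilityTheory Filter Topology

noncomputable section

namespace StochReg

/-! ### Stationary Gaussian processes and their spectral densities -/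

/-- Lag-`h` autocovariance matrix `Γ_X(h) = Cov(X⁰, X^h)`; for a covariance-stationary process this
is `Cov(X^t, X^{t+h})` for every `t`. -/
def autocov {Ω ι : Type*} [MeasurableSpace Ω] [Fintype ι]
    (X : ℤ → Ω → EuclideanSpace ℝ ι) (μ : Measure Ω) (h : ℤ) : Matrix ι ι ℝ :=
  Matrix.of fun i j => cov[fun ω => X 0 ω i, fun ω => X h ω j; μ]

/-- Centered, (covariance-)stationary Gaussian process indexed by `ℤ`. -/
structure IsStationaryGaussian {Ω ι : Type*} [MeasurableSpace Ω] [Fintype ι]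
    (X : ℤ → Ω → EuclideanSpace ℝ ι) (μ : Measure Ω) : Prop where
  gaussian : IsGaussianProcess X μ
  centered : ∀ t i, ∫ ω, X t ω i ∂μ = 0
  stationary : ∀ t h i j,
    cov[fun ω => X t ω i, fun ω => X (t + h) ω j; μ] = autocov X μ h i j

/-- A real-valued process regarded as a vector-valued process of dimension one. -/
def scalarProcess {Ω : Type*} (e : ℤ → Ω → ℝ) : ℤ → Ω → EuclideanSpace ℝ (Fin 1) :=
  fun t ω => !₂[e t ω]

/-- Lebesgue measure on the frequency interval `[-π, π]`. -/
def freqMeasure : Measure ℝ := volume.restrict (Set.Icc (-Real.pi) Real.pi)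

/-- Partial sums `(1 / 2π) ∑_{|ℓ| ≤ N} Γ(ℓ) e^{-iℓθ}` of the spectral density series. -/
def spectralPartialSum {ι : Type*} (Γ : ℤ → Matrix ι ι ℝ) (N : ℕ) (θ : ℝ) : Matrix ι ι ℂ :=
  Matrix.of fun i j => (1 / (2 * Real.pi) : ℂ) *
    ∑ l ∈ Finset.Icc (-(N : ℤ)) (N : ℤ), (Γ l i j : ℂ) * Complex.exp (-Complex.I * l * θ)

/-- `f` is (a version of) the spectral density of an autocovariance function `Γ`:
`f(θ) = (1 / 2π) ∑_ℓ Γ(ℓ) e^{-iℓθ}`, where the series converges, entry by entry, in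
`L²[-π, π]`. This determines `f` up to a null set. -/
structure IsSpectralDensity {ι : Type*} (Γ : ℤ → Matrix ι ι ℝ) (f : ℝ → Matrix ι ι ℂ) :
    Prop where
  memLp : ∀ i j, MemLp (fun θ => f θ i j) 2 freqMeasure
  tendsto : ∀ i j, Tendsto
    (fun N : ℕ => eLpNorm (fun θ => spectralPartialSum Γ N θ i j - f θ i j) 2 freqMeasure)
    atTop (𝓝 0)

/-- The largest eigenvalue of a Hermitian matrix: for a complex matrix `A`, `spectrum ℝ A` is the
set of its real eigenvalues, and these are all the eigenvalues when `A` is Hermitian. -/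
def maxEig {ι : Type*} [Fintype ι] [DecidableEq ι] (A : Matrix ι ι ℂ) : ℝ :=
  sSup (spectrum ℝ A)

/-- The smallest eigenvalue of a Hermitian matrix. -/
def minEig {ι : Type*} [Fintype ι] [DecidableEq ι] (A : Matrix ι ι ℂ) : ℝ :=
  sInf (spectrum ℝ A)

/-- The largest eigenvalue of `f` is essentially bounded on `[-π, π]`, i.e. the essential supremum
`stabM f` below is finite. -/
def BoundedMaxEig {ι : Type*} [Fintype ι] [DecidableEq ι] (f : ℝ → Matrix ι ι ℂ) : Prop :=
  ∃ C : ℝ, ∀ᵐ θ ∂freqMeasure, maxEig (f θ) ≤ C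

/-- `M(f) = ess sup_{θ ∈ [-π, π]} Λ_max (f(θ))`. -/
def stabM {ι : Type*} [Fintype ι] [DecidableEq ι] (f : ℝ → Matrix ι ι ℂ) : ℝ :=
  essSup (fun θ => maxEig (f θ)) freqMeasure

/-- `m(f) = ess inf_{θ ∈ [-π, π]} Λ_min (f(θ))`. -/
def stabm {ι : Type*} [Fintype ι] [DecidableEq ι] (f : ℝ → Matrix ι ι ℂ) : ℝ :=
  essInf (fun θ => minEig (f θ)) freqMeasure

/-- The spectral density of the subprocess with coordinates in `J`. -/
def subDensity {p : ℕ} (f : ℝ → Matrix (Fin p) (Fin p) ℂ) (J : Finset (Fin p)) :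
    ℝ → Matrix J J ℂ :=
  fun θ => (f θ).submatrix (fun i => (i : Fin p)) (fun i => (i : Fin p))

/-- `M(f, k)`, the maximum of `M(f_J)` over the nonempty sets `J` of at most `k` coordinates.
For `k ≥ p` this is a maximum over all nonempty `J`. -/
def stabMk {p : ℕ} (f : ℝ → Matrix (Fin p) (Fin p) ℂ) (k : ℕ) : ℝ :=
  ⨆ J : {J : Finset (Fin p) // J.Nonempty ∧ J.card ≤ k}, stabM (subDensity f J.1)

/-! ### Regression and lasso -/

/-- The `ℓ₁` norm. -/
def l1norm {p : ℕ} (b : EuclideanSpace ℝ (Fin p)) : ℝ := ∑ j, |b j|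

/-- The support of a vector. -/
def supp {p : ℕ} (b : EuclideanSpace ℝ (Fin p)) : Finset (Fin p) :=
  Finset.univ.filter fun j => b j ≠ 0

/-- The response `y^t = ⟨b, X^t⟩ + e^t` of the stochastic regression model. -/
def response {Ω : Type*} {p : ℕ} (b : EuclideanSpace ℝ (Fin p))
    (X : ℤ → Ω → EuclideanSpace ℝ (Fin p)) (e : ℤ → Ω → ℝ) (t : ℤ) (ω : Ω) : ℝ :=
  inner ℝ b (X t ω) + e t ω

/-- The data matrix `[Xⁿ : … : X¹]'`, whose rows are the observed predictors. -/
def dataMatrix {Ω : Type*} {p : ℕ} (n : ℕ) (X : ℤ → Ω → EuclideanSpace ℝ (Fin p)) (ω : Ω) :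
    Matrix (Fin n) (Fin p) ℝ :=
  Matrix.of fun r j => X ((n : ℤ) - (r : ℕ)) ω j

/-- The data vector `[yⁿ : … : y¹]'`. -/
def dataVector {Ω : Type*} (n : ℕ) (y : ℤ → Ω → ℝ) (ω : Ω) : Fin n → ℝ :=
  fun r => y ((n : ℤ) - (r : ℕ)) ω

/-- The squared Euclidean norm `‖v‖²` of a vector in `ℝⁿ`. -/
def sqNorm {n : ℕ} (v : Fin n → ℝ) : ℝ := ∑ r, v r ^ 2

/-- The lasso objective `(1/n) ‖Y - A b‖² + lam ‖b‖₁`. -/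
def lassoObj {n p : ℕ} (Y : Fin n → ℝ) (A : Matrix (Fin n) (Fin p) ℝ) (lam : ℝ)
    (b : EuclideanSpace ℝ (Fin p)) : ℝ :=
  (1 / (n : ℝ)) * sqNorm (Y - A.mulVec b) + lam * l1norm b

/-- `b` is a solution of the lasso problem: a minimizer of the objective over `ℝᵖ`. -/
def IsLassoSolution {n p : ℕ} (Y : Fin n → ℝ) (A : Matrix (Fin n) (Fin p) ℝ) (lam : ℝ)
    (b : EuclideanSpace ℝ (Fin p)) : Prop :=
  ∀ b' : EuclideanSpace ℝ (Fin p), lassoObj Y A lam b ≤ lassoObj Y A lam b'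

/-- Hard thresholding at level `lam`: the `j`-th entry is `b_j 1{|b_j| > lam}`. -/
def hardThreshold {p : ℕ} (lam : ℝ) (b : EuclideanSpace ℝ (Fin p)) :
    EuclideanSpace ℝ (Fin p) :=
  WithLp.toLp 2 fun j => if lam < |b j| then b j else 0

end StochReg

end

namespace StochReg

/-! The lasso analysis is deterministic once two events hold: the noise correlations `(1/n) |⟨column
j, ε⟩|` are at most `lam / 4`, and the empirical Gram form dominates `α ‖v‖²` on the cone `‖v‖₁ ≤ 4
√k ‖v‖` (`lasso_bounds`). The rest shows that both events are likely.

Dependence in time enters only through covariance operators. The projections `⟨x, X^t⟩` at the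
sample times have a Toeplitz covariance matrix whose symbol is the Hermitian form of the spectral
density at `x`, so its operator norm is at most `2π` times the essential supremum of the symbol, and
its diagonal is at least `2π` times the essential infimum (`IsStationaryGaussian.variance_sum_le`,
`IsStationaryGaussian.le_variance_proj`). A centered Gaussian vector becomes independent after
rotation to the eigenbasis of its covariance, so its squared norm concentrates by Chernoff's method
at a rate set by that operator norm. Polarization transfers this to the products of predictors and
noise (`measure_abs_sum_mul_gt_le`).

The restricted eigenvalue bound uses Maurey's empirical method instead of a net of the sphere. A
vector `v` is the mean of random multiples `± ‖v‖₁ e_j`; averaging a quadratic form over sums of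
`2k` independent draws returns its value at `v` up to a diagonal error of order `‖v‖₁² / k`, which
is of order `‖v‖²` on the cone (`quadraticForm_lower_bound`). So deviations need control only at the
at most `(2p)^(2k)` signed sums of basis vectors and, from above, at the basis vectors. A union
bound of size `exp(O(k log p))` pays for these, which is what the sample size condition allows. -/

/-! ### Concentration of the squared norm of a Gaussian vector. -/

lemma integrable_exp_mul_sq_gaussianReal (v : NNReal) {t : ℝ} (h : 2 * t * v < 1) :
    Integrable (fun x : ℝ => Real.exp (t * x ^ 2)) (gaussianReal 0 v) ∧
      ∫ x, Real.exp (t * x ^ 2) ∂gaussianReal 0 v = (√(1 - 2 * t * v))⁻¹ := by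
  rcases eq_or_ne v 0 with rfl | hv
  · simp [gaussianReal_zero_var, integrable_dirac]
  have hv0 : (0 : ℝ) < v := by positivity
  have hb : 0 < (1 - 2 * t * v) / (2 * v) := by
    have : 0 < 1 - 2 * t * v := by linarith
    positivity
  have key : ∀ x : ℝ, gaussianPDFReal 0 v x • Real.exp (t * x ^ 2) =
      (√(2 * Real.pi * v))⁻¹ * Real.exp (-((1 - 2 * t * v) / (2 * v)) * x ^ 2) := by
    intro x
    rw [gaussianPDFReal_def, smul_eq_mul, mul_assoc, ← Real.exp_add]
    congr 2
    field_simp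
    ring
  constructor
  · rw [gaussianReal_of_var_ne_zero 0 hv, gaussianPDF_def]
    rw [integrable_withDensity_iff_integrable_smul₀' (by fun_prop) (by simp)]
    simp only [ENNReal.toReal_ofReal (gaussianPDFReal_nonneg _ _ _), key]
    exact (integrable_exp_neg_mul_sq hb).const_mul _
  · rw [integral_gaussianReal_eq_integral_smul hv]
    simp only [key]
    rw [integral_const_mul, integral_gaussian, ← Real.sqrt_inv, ← Real.sqrt_inv,
      ← Real.sqrt_mul (by positivity)]
    congr 1
    have : (1 - 2 * t * v) ≠ 0 := by linarith
    field_simp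

/-- From `log (1 - u) ≥ 1 - 1/(1 - u) ≥ -u - 2u²`. No lower bound on `u` is imposed, so one estimate
serves both tails. -/
lemma inv_sqrt_one_sub_le_exp {u : ℝ} (hu : u ≤ 1 / 2) :
    (√(1 - u))⁻¹ ≤ Real.exp (u / 2 + u ^ 2) := by
  have h0 : 0 < 1 - u := by linarith
  have h1 := Real.one_sub_inv_le_log_of_pos h0
  have h2 : -u - 2 * u ^ 2 ≤ 1 - (1 - u)⁻¹ := by
    have : 1 - (1 - u)⁻¹ - (-u - 2 * u ^ 2) = u ^ 2 * (1 - 2 * u) * (1 - u)⁻¹ := by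
      field_simp; ring
    have h3 : 0 ≤ u ^ 2 * (1 - 2 * u) * (1 - u)⁻¹ := by
      have : 0 ≤ 1 - 2 * u := by linarith
      positivity
    linarith
  rw [Real.sqrt_eq_rpow, ← Real.rpow_neg h0.le, Real.rpow_def_of_pos h0]
  gcongr
  nlinarith

lemma mgf_sq_le {Ω : Type*} [MeasurableSpace Ω] {μ : Measure Ω} [IsProbabilityMeasure μ]
    {V : Ω → ℝ} (hV : HasGaussianLaw V μ) (h0 : ∫ ω, V ω ∂μ = 0) {t : ℝ}
    (ht : t * Var[V; μ] ≤ 1 / 4) :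
    Integrable (fun ω => Real.exp (t * V ω ^ 2)) μ ∧
      mgf (fun ω => V ω ^ 2) μ t ≤ Real.exp (t * Var[V; μ] + 4 * t ^ 2 * Var[V; μ] ^ 2) := by
  have hmap : μ.map V = gaussianReal 0 Var[V; μ].toNNReal := by
    rw [hV.map_eq_gaussianReal, h0]
  have hc : ((Var[V; μ].toNNReal : NNReal) : ℝ) = Var[V; μ] :=
    Real.coe_toNNReal _ (variance_nonneg _ _)
  have hVm := hV.aemeasurable
  obtain ⟨h1, h2⟩ := integrable_exp_mul_sq_gaussianReal Var[V; μ].toNNReal (t := t)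
    (by rw [hc]; linarith)
  rw [← hmap] at h1 h2
  constructor
  · exact h1.comp_aemeasurable hVm
  · rw [integral_map hVm (by fun_prop), hc] at h2
    rw [mgf, h2]
    refine (inv_sqrt_one_sub_le_exp (by linarith)).trans (Real.exp_le_exp.2 (le_of_eq ?_))
    ring

lemma iIndepFun_mgf_sum_sq_le {Ω : Type*} [MeasurableSpace Ω] {μ : Measure Ω}
    [IsProbabilityMeasure μ] {n : ℕ} {V : Fin n → Ω → ℝ} (hV : ∀ i, HasGaussianLaw (V i) μ)
    (hi : iIndepFun V μ) (h0 : ∀ i, ∫ ω, V i ω ∂μ = 0) {t K : ℝ}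
    (hK : ∀ i, Var[V i; μ] ≤ K) (ht : ∀ i, t * Var[V i; μ] ≤ 1 / 4) :
    Integrable (fun ω => Real.exp (t * ∑ i, V i ω ^ 2)) μ ∧
      mgf (fun ω => ∑ i, V i ω ^ 2) μ t ≤
        Real.exp (t * ∑ i, Var[V i; μ] + 4 * t ^ 2 * (n * K ^ 2)) := by
  have hsq : iIndepFun (fun i ω => V i ω ^ 2) μ :=
    hi.comp (fun _ x => x ^ 2) (fun _ => by fun_prop)
  have hexp : iIndepFun (fun i ω => Real.exp (t * V i ω ^ 2)) μ :=
    hi.comp (fun _ x => Real.exp (t * x ^ 2)) (fun _ => by fun_prop)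
  have hm : ∀ i, AEMeasurable (fun ω => V i ω ^ 2) μ := fun i =>
    (hV i).aemeasurable.pow_const 2
  have hsum : (fun ω => ∑ i, V i ω ^ 2) = ∑ i, (fun ω => V i ω ^ 2) := by
    ext ω; simp
  have hmgf := hsq.mgf_sum₀ hm (t := t) Finset.univ
  have hpos : ∀ i, 0 < mgf (fun ω => V i ω ^ 2) μ t := fun i =>
    mgf_pos (mgf_sq_le (hV i) (h0 i) (ht i)).1
  constructor
  · rw [← mgf_pos_iff, hsum, hmgf]
    exact Finset.prod_pos fun i _ => hpos i
  · rw [hsum, hmgf]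
    calc ∏ i, mgf (fun ω => V i ω ^ 2) μ t
        ≤ ∏ i, Real.exp (t * Var[V i; μ] + 4 * t ^ 2 * K ^ 2) := by
          refine Finset.prod_le_prod (fun i _ => (hpos i).le) fun i _ => ?_
          refine (mgf_sq_le (hV i) (h0 i) (ht i)).2.trans (Real.exp_le_exp.2 ?_)
          have := variance_nonneg (V i) μ
          have := hK i
          gcongr
      _ = _ := by
          rw [← Real.exp_sum, Finset.sum_add_distrib, ← Finset.mul_sum]
          simp
          ring

/-- The moment generating function of the squared norm of a centered Gaussian vector whose
covariance matrix is bounded by `K`. -/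
lemma gaussian_mgf_sum_sq_le {Ω : Type*} [MeasurableSpace Ω] {μ : Measure Ω}
    [IsProbabilityMeasure μ] {n : ℕ} {W : Fin n → Ω → ℝ}
    (hW : HasGaussianLaw (fun ω i => W i ω) μ) (h0 : ∀ i, ∫ ω, W i ω ∂μ = 0) {t K : ℝ}
    (hK : ∀ a : Fin n → ℝ, Var[fun ω => ∑ i, a i * W i ω; μ] ≤ K * ∑ i, a i ^ 2)
    (ht : t * K ≤ 1 / 4) :
    Integrable (fun ω => Real.exp (t * ∑ i, W i ω ^ 2)) μ ∧
      mgf (fun ω => ∑ i, W i ω ^ 2) μ t ≤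
        Real.exp (t * ∑ i, Var[W i; μ] + 4 * t ^ 2 * (n * K ^ 2)) := by
  have hWi : ∀ i, HasGaussianLaw (W i) μ := fun i => hW.eval i
  have hL2 : ∀ i, MemLp (W i) 2 μ := fun i => (hWi i).memLp_two
  let Q : Matrix (Fin n) (Fin n) ℝ := Matrix.of fun i j => cov[W i, W j; μ]
  have hQ : Q.IsHermitian := by
    ext i j; simp [Q, covariance_comm (W i)]
  -- The coordinates `V` in an eigenbasis of the covariance are jointly Gaussian and uncorrelated,
  -- hence independent. The rotation preserves both the squared norm and the trace.
  let u := hQ.eigenvectorBasis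
  let V : Fin n → Ω → ℝ := fun i ω => ∑ j, u i j * W j ω
  have hinner : ∀ i ω, V i ω = inner ℝ (u i) (WithLp.toLp 2 fun j => W j ω) := by
    intro i ω
    simp [V, PiLp.inner_apply, mul_comm]
  have hcov : ∀ a b : Fin n → ℝ, cov[fun ω => ∑ j, a j * W j ω, fun ω => ∑ j, b j * W j ω; μ]
      = a ⬝ᵥ Q.mulVec b := by
    intro a b
    rw [covariance_fun_sum_fun_sum (fun i => (hL2 i).const_mul _) (fun i => (hL2 i).const_mul _)]
    simp only [covariance_const_mul_left, covariance_const_mul_right, dotProduct, Matrix.mulVec,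
      Finset.mul_sum, Q, Matrix.of_apply]
    refine Finset.sum_congr rfl fun i _ => Finset.sum_congr rfl fun j _ => ?_
    ring
  have hVcov : ∀ i j, cov[V i, V j; μ] = if i = j then hQ.eigenvalues j else 0 := by
    intro i j
    have h1 := hcov (u i) (u j)
    rw [hQ.mulVec_eigenvectorBasis, dotProduct_smul] at h1
    have h2 := orthonormal_iff_ite.1 u.orthonormal i j
    rw [PiLp.inner_apply] at h2
    have h3 : (u i : Fin n → ℝ) ⬝ᵥ (u j : Fin n → ℝ) = if i = j then 1 else 0 := by
      rw [← h2]; simp [dotProduct, mul_comm]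
    change cov[V i, V j; μ] = _ at h1
    rw [h1]
    change _ • ((u i : Fin n → ℝ) ⬝ᵥ (u j : Fin n → ℝ)) = _
    rw [h3]
    split_ifs <;> simp
  have hVlaw : HasGaussianLaw (fun ω i => V i ω) μ := by
    let M : Matrix (Fin n) (Fin n) ℝ := Matrix.of fun i j => u i j
    have := hW.map_fun (LinearMap.toContinuousLinearMap (Matrix.toLin' M))
    exact this
  have hind : iIndepFun V μ := hVlaw.iIndepFun_of_covariance_eq_zero
    fun i j hij => by rw [hVcov, if_neg hij]
  have hVi : ∀ i, HasGaussianLaw (V i) μ := fun i => hVlaw.eval i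
  have hV0 : ∀ i, ∫ ω, V i ω ∂μ = 0 := by
    intro i
    simp only [V]
    rw [integral_finsetSum _ fun j _ => (hWi j).integrable.const_mul _]
    simp [integral_const_mul, h0]
  have hVvar : ∀ i, Var[V i; μ] = hQ.eigenvalues i := by
    intro i
    rw [← covariance_self (hVi i).aemeasurable, hVcov, if_pos rfl]
  have hVK : ∀ i, Var[V i; μ] ≤ K := by
    intro i
    have h := hK (u i)
    have h2 := orthonormal_iff_ite.1 u.orthonormal i i
    rw [if_pos rfl, PiLp.inner_apply] at h2
    have h3 : ∑ j, (u i j) ^ 2 = 1 := by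
      rw [← h2]; simp [sq]
    rwa [h3, mul_one] at h
  have hsq : (fun ω => ∑ i, W i ω ^ 2) = fun ω => ∑ i, V i ω ^ 2 := by
    ext ω
    have h := u.sum_sq_norm_inner_right (WithLp.toLp 2 fun j => W j ω)
    rw [EuclideanSpace.norm_sq_eq] at h
    simp only [hinner]
    simpa using h.symm
  have htr : ∑ i, Var[W i; μ] = ∑ i, Var[V i; μ] := by
    simp only [hVvar]
    have := hQ.trace_eq_sum_eigenvalues
    rw [Matrix.trace] at this
    simp only [RCLike.ofReal_real_eq_id, id] at this
    rw [← this]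
    refine Finset.sum_congr rfl fun i _ => ?_
    rw [← covariance_self (hWi i).aemeasurable]
    rfl
  have ht' : ∀ i, t * Var[V i; μ] ≤ 1 / 4 := by
    intro i
    have h1 := variance_nonneg (V i) μ
    have h2 := hVK i
    rcases le_total t 0 with h | h
    · nlinarith
    · nlinarith
  have hmain := iIndepFun_mgf_sum_sq_le hVi hind hV0 hVK ht'
  have hsq' := congrFun hsq
  simp only [hsq', htr]
  exact hmain

/-- Upper tail bound for the squared norm of a centered Gaussian vector. -/
lemma gaussian_measure_sum_sq_ge_le {Ω : Type*} [MeasurableSpace Ω] {μ : Measure Ω}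
    [IsProbabilityMeasure μ] {n : ℕ} {W : Fin n → Ω → ℝ}
    (hW : HasGaussianLaw (fun ω i => W i ω) μ) (h0 : ∀ i, ∫ ω, W i ω ∂μ = 0) {K δ : ℝ}
    (hK0 : 0 < K)
    (hK : ∀ a : Fin n → ℝ, Var[fun ω => ∑ i, a i * W i ω; μ] ≤ K * ∑ i, a i ^ 2)
    (hδ : 0 ≤ δ) (hδK : δ ≤ 2 * K) :
    μ.real {ω | ∑ i, Var[W i; μ] + n * δ ≤ ∑ i, W i ω ^ 2} ≤
      Real.exp (-(n * δ ^ 2 / (16 * K ^ 2))) := by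
  -- The parameter `t = δ / (8K²)` minimizes `-t n δ + 4 t² n K²`. The constraint `t K ≤ 1/4` is
  -- exactly `δ ≤ 2K`.
  have ht : δ / (8 * K ^ 2) * K ≤ 1 / 4 := by
    rw [div_mul_eq_mul_div, div_le_iff₀ (by positivity)]
    nlinarith
  obtain ⟨h1, h2⟩ := gaussian_mgf_sum_sq_le hW h0 hK ht
  refine (measure_ge_le_exp_mul_mgf _ (by positivity) h1).trans ?_
  refine (mul_le_mul_of_nonneg_left h2 (Real.exp_pos _).le).trans ?_
  rw [← Real.exp_add]
  refine Real.exp_le_exp.2 (le_of_eq ?_)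
  field_simp
  ring

/-- Lower tail bound for the squared norm of a centered Gaussian vector. -/
lemma gaussian_measure_sum_sq_le_le {Ω : Type*} [MeasurableSpace Ω] {μ : Measure Ω}
    [IsProbabilityMeasure μ] {n : ℕ} {W : Fin n → Ω → ℝ}
    (hW : HasGaussianLaw (fun ω i => W i ω) μ) (h0 : ∀ i, ∫ ω, W i ω ∂μ = 0) {K δ : ℝ}
    (hK0 : 0 < K)
    (hK : ∀ a : Fin n → ℝ, Var[fun ω => ∑ i, a i * W i ω; μ] ≤ K * ∑ i, a i ^ 2)
    (hδ : 0 ≤ δ) :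
    μ.real {ω | ∑ i, W i ω ^ 2 ≤ ∑ i, Var[W i; μ] - n * δ} ≤
      Real.exp (-(n * δ ^ 2 / (16 * K ^ 2))) := by
  -- With a negative parameter the constraint `t K ≤ 1/4` is automatic, so `δ` needs no upper bound
  -- here.
  have ht0 : -(δ / (8 * K ^ 2)) ≤ 0 := by
    have : 0 ≤ δ / (8 * K ^ 2) := by positivity
    linarith
  have ht : -(δ / (8 * K ^ 2)) * K ≤ 1 / 4 := by nlinarith
  obtain ⟨h1, h2⟩ := gaussian_mgf_sum_sq_le hW h0 hK ht
  refine (measure_le_le_exp_mul_mgf _ ht0 h1).trans ?_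
  refine (mul_le_mul_of_nonneg_left h2 (Real.exp_pos _).le).trans ?_
  rw [← Real.exp_add]
  refine Real.exp_le_exp.2 (le_of_eq ?_)
  field_simp
  ring

/-! ### Fourier coefficients and symmetry of the spectral density. -/

instance : IsFiniteMeasure freqMeasure := by unfold freqMeasure; infer_instance

instance : NeZero freqMeasure := by
  refine ⟨fun h => ?_⟩
  have h1 : freqMeasure Set.univ = 0 := by rw [h]; simp
  rw [freqMeasure, Measure.restrict_apply_univ, Real.volume_Icc] at h1
  have := Real.pi_pos
  rw [ENNReal.ofReal_eq_zero] at h1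
  linarith

lemma integral_freqMeasure_exp (m : ℤ) :
    ∫ θ, Complex.exp (Complex.I * m * θ) ∂freqMeasure = if m = 0 then (2 * Real.pi : ℂ) else 0 := by
  have hpi : (-Real.pi) ≤ Real.pi := by linarith [Real.pi_pos]
  rw [freqMeasure, integral_Icc_eq_integral_Ioc, ← intervalIntegral.integral_of_le hpi]
  split_ifs with h
  · simp [h]; ring
  · have hc : Complex.I * m ≠ 0 := by simp [h]
    rw [integral_exp_mul_complex hc]
    have : Complex.exp (Complex.I * m * Real.pi) =
        Complex.exp (Complex.I * m * ((-Real.pi : ℝ) : ℂ)) := by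
      rw [Complex.exp_eq_exp_iff_exists_int]
      exact ⟨m, by push_cast; ring⟩
    rw [this, sub_self, zero_div]

lemma norm_exp_I_mul_int_mul (m : ℤ) (θ : ℝ) : ‖Complex.exp (Complex.I * m * θ)‖ = 1 := by
  have : Complex.I * m * θ = ((m * θ : ℝ) : ℂ) * Complex.I := by push_cast; ring
  rw [this, Complex.norm_exp_ofReal_mul_I]

lemma continuous_spectralPartialSum {ι : Type*} (Γ : ℤ → Matrix ι ι ℝ) (N : ℕ) (i j : ι) :
    Continuous fun θ => spectralPartialSum Γ N θ i j := by
  simp only [spectralPartialSum, Matrix.of_apply]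
  fun_prop

lemma integrable_freqMeasure_of_continuous {g : ℝ → ℂ} (hg : Continuous g) :
    Integrable g freqMeasure := hg.continuousOn.integrableOn_compact isCompact_Icc

lemma integral_spectralPartialSum_mul_exp {ι : Type*} (Γ : ℤ → Matrix ι ι ℝ) (l : ℤ) (N : ℕ)
    (hN : l.natAbs ≤ N) (i j : ι) :
    ∫ θ, spectralPartialSum Γ N θ i j * Complex.exp (Complex.I * l * θ) ∂freqMeasure = Γ l i j := by
  have h1 : ∀ θ : ℝ, spectralPartialSum Γ N θ i j * Complex.exp (Complex.I * l * θ) =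
      ∑ k ∈ Finset.Icc (-(N : ℤ)) N, ((1 / (2 * Real.pi) : ℂ) * Γ k i j) *
        Complex.exp (Complex.I * (l - k : ℤ) * θ) := by
    intro θ
    simp only [spectralPartialSum, Matrix.of_apply, Finset.mul_sum, Finset.sum_mul]
    refine Finset.sum_congr rfl fun k _ => ?_
    have : Complex.exp (Complex.I * (l - k : ℤ) * θ) =
        Complex.exp (-Complex.I * k * θ) * Complex.exp (Complex.I * l * θ) := by
      rw [← Complex.exp_add]
      congr 1
      push_cast; ring
    rw [this]
    ring
  simp only [h1]
  rw [integral_finsetSum _ fun k _ => integrable_freqMeasure_of_continuous (by fun_prop)]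
  simp only [integral_const_mul, integral_freqMeasure_exp, sub_eq_zero]
  rw [Finset.sum_eq_single l]
  · have : (Real.pi : ℂ) ≠ 0 := by simp [Real.pi_ne_zero]
    simp
    field_simp
  · intro b _ hb
    simp [hb.symm]
  · intro h
    exact absurd (Finset.mem_Icc.2 ⟨by omega, by omega⟩) h

/-- Fourier inversion: the autocovariances are the Fourier coefficients of the spectral density. -/
lemma IsSpectralDensity.integral_mul_exp {ι : Type*} {Γ : ℤ → Matrix ι ι ℝ}
    {f : ℝ → Matrix ι ι ℂ} (h : IsSpectralDensity Γ f) (l : ℤ) (i j : ι) :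
    ∫ θ, f θ i j * Complex.exp (Complex.I * l * θ) ∂freqMeasure = Γ l i j := by
  have hint : Integrable (fun θ => f θ i j) freqMeasure := (h.memLp i j).integrable (by norm_num)
  have hexpm : AEStronglyMeasurable (fun θ : ℝ => Complex.exp (Complex.I * l * θ)) freqMeasure :=
    (by fun_prop : Continuous fun θ : ℝ => Complex.exp (Complex.I * l * θ)).aestronglyMeasurable
  have hb : ∀ᵐ θ : ℝ ∂freqMeasure, ‖Complex.exp (Complex.I * l * θ)‖ ≤ 1 :=
    ae_of_all _ fun θ => (norm_exp_I_mul_int_mul l θ).le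
  -- On a finite measure space `L²` convergence implies `L¹` convergence, and the exponential has
  -- modulus one. The coefficients of the partial sums are constant once `N ≥ |l|`, so the limit is
  -- that constant.
  have h1 : Tendsto (fun N : ℕ => ∫ θ, spectralPartialSum Γ N θ i j *
      Complex.exp (Complex.I * l * θ) ∂freqMeasure) atTop
      (𝓝 (∫ θ, f θ i j * Complex.exp (Complex.I * l * θ) ∂freqMeasure)) := by
    refine tendsto_integral_of_L1 _ (hint.mul_bdd hexpm hb).aestronglyMeasurable
      (Eventually.of_forall fun N => integrable_freqMeasure_of_continuous
        ((continuous_spectralPartialSum Γ N i j).mul (by fun_prop))) ?_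
    have h2 := h.tendsto i j
    have h3 : Tendsto (fun N : ℕ =>
        eLpNorm (fun θ => spectralPartialSum Γ N θ i j - f θ i j) 2 freqMeasure *
          freqMeasure Set.univ ^ (1 / (1 : ENNReal).toReal - 1 / (2 : ENNReal).toReal))
        atTop (𝓝 0) := by
      have := ENNReal.Tendsto.mul_const (b := freqMeasure Set.univ ^
        (1 / (1 : ENNReal).toReal - 1 / (2 : ENNReal).toReal)) h2 (Or.inr ?_)
      · simpa using this
      · exact ENNReal.rpow_ne_top_of_nonneg (by norm_num) (measure_ne_top _ _)
    refine tendsto_of_tendsto_of_tendsto_of_le_of_le tendsto_const_nhds h3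
      (fun _ => zero_le) fun N => ?_
    refine le_trans (le_of_eq ?_) (eLpNorm_le_eLpNorm_mul_rpow_measure_univ (p := 1) (q := 2)
      (by norm_num) ((continuous_spectralPartialSum Γ N i j).aestronglyMeasurable.sub
        hint.aestronglyMeasurable))
    rw [eLpNorm_one_eq_lintegral_enorm]
    refine lintegral_congr fun θ => ?_
    rw [← sub_mul, enorm_mul]
    have : ‖Complex.exp (Complex.I * l * θ)‖ₑ = 1 := by
      rw [← ofReal_norm, norm_exp_I_mul_int_mul]; simp
    rw [this, mul_one]
  refine tendsto_nhds_unique h1 (tendsto_const_nhds.congr' ?_)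
  filter_upwards [eventually_ge_atTop l.natAbs] with N hN
  rw [integral_spectralPartialSum_mul_exp Γ l N hN]

lemma star_spectralPartialSum {ι : Type*} {Γ : ℤ → Matrix ι ι ℝ}
    (hΓ : ∀ l i j, Γ (-l) i j = Γ l j i) (N : ℕ) (θ : ℝ) (i j : ι) :
    star (spectralPartialSum Γ N θ j i) = spectralPartialSum Γ N θ i j := by
  simp only [spectralPartialSum, Matrix.of_apply, star_mul', star_sum, Complex.star_def]
  congr 1
  · simp [Complex.conj_ofNat]
  · refine Finset.sum_nbij' (fun l => -l) (fun l => -l) ?_ ?_ ?_ ?_ ?_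
    · intro l hl; simp only [Finset.mem_Icc] at *; omega
    · intro l hl; simp only [Finset.mem_Icc] at *; omega
    · simp
    · simp
    · intro l _
      rw [hΓ, ← Complex.exp_conj, Complex.conj_ofReal]
      congr 2
      simp

/-- The partial sums are Hermitian because `Γ(-l)` is the transpose of `Γ(l)`, and the symmetry
passes to the `L²` limit, hence only almost everywhere. -/
lemma IsSpectralDensity.ae_isHermitian {ι : Type*} [Fintype ι] {Γ : ℤ → Matrix ι ι ℝ}
    {f : ℝ → Matrix ι ι ℂ} (h : IsSpectralDensity Γ f) (hΓ : ∀ l i j, Γ (-l) i j = Γ l j i) :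
    ∀ᵐ θ ∂freqMeasure, (f θ).IsHermitian := by
  have key : ∀ i j, ∀ᵐ θ ∂freqMeasure, star (f θ j i) = f θ i j := by
    intro i j
    have hm := fun i j => (h.memLp i j).aestronglyMeasurable
    have hsm : AEStronglyMeasurable (fun θ => star (f θ j i)) freqMeasure :=
      continuous_star.comp_aestronglyMeasurable (hm j i)
    have hz : eLpNorm (fun θ => star (f θ j i) - f θ i j) 2 freqMeasure = 0 := by
      refine le_antisymm ?_ zero_le
      have hlim := (h.tendsto j i).add (h.tendsto i j)
      rw [add_zero] at hlim
      refine ge_of_tendsto' hlim fun N => ?_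
      have hc := fun i j => (continuous_spectralPartialSum Γ N i j).aestronglyMeasurable
        (μ := freqMeasure)
      have e1 : eLpNorm (fun θ => spectralPartialSum Γ N θ j i - f θ j i) 2 freqMeasure =
          eLpNorm (fun θ => star (f θ j i) - spectralPartialSum Γ N θ i j) 2 freqMeasure := by
        refine eLpNorm_congr_norm_ae (ae_of_all _ fun θ => ?_)
        rw [← star_spectralPartialSum hΓ N θ i j, ← star_sub, norm_star, norm_sub_rev]
      rw [e1]
      refine le_trans (le_of_eq ?_) (eLpNorm_add_le (hsm.sub (hc i j)) ((hc i j).sub (hm i j))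
        (by norm_num))
      congr 1
      ext θ
      simp
    have hz' := (eLpNorm_eq_zero_iff (hsm.sub (hm i j)) (by norm_num)).1 hz
    filter_upwards [hz'] with θ hθ
    exact sub_eq_zero.1 hθ
  have : ∀ᵐ θ ∂freqMeasure, ∀ i j, star (f θ j i) = f θ i j := by
    rw [ae_all_iff]; intro i; rw [ae_all_iff]; exact key i
  filter_upwards [this] with θ hθ
  ext i j
  exact hθ i j

/-! ### Eigenvalue bounds for the symbol, and sparse vectors. -/

/-- The Hermitian form of a matrix at a real vector. -/
def realForm {ι : Type*} [Fintype ι] (A : Matrix ι ι ℂ) (x : ι → ℝ) : ℂ :=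
  ∑ i, ∑ j, (x i : ℂ) * x j * A i j

lemma realForm_eq {ι : Type*} [Fintype ι] (A : Matrix ι ι ℂ) (x : ι → ℝ) :
    realForm A x = star (fun i => (x i : ℂ)) ⬝ᵥ A.mulVec (fun i => (x i : ℂ)) := by
  simp only [realForm, dotProduct, Matrix.mulVec, Pi.star_apply, Complex.star_def,
    Complex.conj_ofReal, Finset.mul_sum]
  refine Finset.sum_congr rfl fun i _ => Finset.sum_congr rfl fun j _ => by ring

-- The spectrum lies between its extremes, so `minEig A • 1 ≤ A ≤ maxEig A • 1` in the Loewner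
-- order; evaluate at `x`.
open scoped MatrixOrder in
lemma realForm_re_le_of_isHermitian {ι : Type*} [Fintype ι] [DecidableEq ι] {A : Matrix ι ι ℂ}
    (hA : A.IsHermitian) (x : ι → ℝ) :
    (realForm A x).re ≤ maxEig A * ∑ i, x i ^ 2 ∧ minEig A * ∑ i, x i ^ 2 ≤ (realForm A x).re := by
  have hb := Matrix.finite_real_spectrum (A := A)
  have hid : ∀ c : ℝ, (realForm (algebraMap ℝ (Matrix ι ι ℂ) c) x).re = c * ∑ i, x i ^ 2 := by
    intro c
    rw [realForm_eq, Algebra.algebraMap_eq_smul_one, Matrix.smul_mulVec, Matrix.one_mulVec]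
    simp [dotProduct, Finset.mul_sum]
    refine Finset.sum_congr rfl fun i _ => by ring
  constructor
  · have h : A ≤ algebraMap ℝ _ (maxEig A) :=
      le_algebraMap_of_spectrum_le (fun r hr => le_csSup hb.bddAbove hr) hA.isSelfAdjoint
    have h2 := (Matrix.le_iff.1 h).re_dotProduct_nonneg (fun i => (x i : ℂ))
    rw [Matrix.sub_mulVec, dotProduct_sub, ← realForm_eq, ← realForm_eq] at h2
    simp only [RCLike.re_eq_complex_re, Complex.sub_re, hid] at h2
    linarith
  · have h : algebraMap ℝ _ (minEig A) ≤ A :=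
      algebraMap_le_of_le_spectrum (fun r hr => csInf_le hb.bddBelow hr) hA.isSelfAdjoint
    have h2 := (Matrix.le_iff.1 h).re_dotProduct_nonneg (fun i => (x i : ℂ))
    rw [Matrix.sub_mulVec, dotProduct_sub, ← realForm_eq, ← realForm_eq] at h2
    simp only [RCLike.re_eq_complex_re, Complex.sub_re, hid] at h2
    linarith

lemma ae_maxEig_le_stabM {ι : Type*} [Fintype ι] [DecidableEq ι] {f : ℝ → Matrix ι ι ℂ}
    (h : BoundedMaxEig f) : ∀ᵐ θ ∂freqMeasure, maxEig (f θ) ≤ stabM f := by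
  obtain ⟨C, hC⟩ := h
  exact ae_le_essSup ⟨C, by simpa using hC⟩

lemma ae_stabm_le_minEig {ι : Type*} [Fintype ι] [DecidableEq ι] {f : ℝ → Matrix ι ι ℂ}
    (h : 0 < stabm f) : ∀ᵐ θ ∂freqMeasure, stabm f ≤ minEig (f θ) := by
  by_cases hne : ∃ c : ℝ, ∀ᵐ θ ∂freqMeasure, c ≤ minEig (f θ)
  · obtain ⟨C, hC⟩ := hne
    exact ae_essInf_le ⟨C, by simpa using hC⟩
  -- A real `essInf` with no almost sure lower bound is the supremum of the empty set, which is `0`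
  -- by convention; positivity rules this out.
  · exfalso
    have : stabm f = 0 := by
      rw [stabm, essInf_eq_sSup]
      have hempty : {a | freqMeasure {θ | minEig (f θ) < a} = 0} = ∅ := by
        rw [Set.eq_empty_iff_forall_notMem]
        intro a ha
        refine hne ⟨a, ?_⟩
        rw [ae_iff]
        simpa using ha
      rw [hempty]
      exact Real.sSup_empty
    linarith

-- A Loewner upper bound by a scalar matrix restricts to principal submatrices. `Nonempty κ` avoids
-- the default value `sSup ∅ = 0`.
open scoped MatrixOrder ComplexOrder in
lemma maxEig_submatrix_le {ι κ : Type*} [Fintype ι] [DecidableEq ι] [Fintype κ] [DecidableEq κ]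
    [Nonempty κ] {A : Matrix ι ι ℂ} (hA : A.IsHermitian) {e : κ → ι} (he : Function.Injective e) :
    maxEig (A.submatrix e e) ≤ maxEig A := by
  have hS : (A.submatrix e e).IsHermitian := hA.submatrix e
  have h : A ≤ algebraMap ℝ _ (maxEig A) :=
    le_algebraMap_of_spectrum_le (fun r hr => le_csSup (Matrix.finite_real_spectrum).bddAbove hr)
      hA.isSelfAdjoint
  have h2 := (Matrix.le_iff.1 h).submatrix e
  have h3 : A.submatrix e e ≤ algebraMap ℝ (Matrix κ κ ℂ) (maxEig A) := by
    rw [Matrix.le_iff]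
    convert h2 using 1
    ext i j
    simp [Matrix.algebraMap_matrix_apply, he.eq_iff]
  rw [le_algebraMap_iff_spectrum_le hS.isSelfAdjoint] at h3
  refine csSup_le ?_ h3
  rw [hS.spectrum_real_eq_range_eigenvalues]
  exact Set.range_nonempty _

lemma BoundedMaxEig.subDensity {p : ℕ} {f : ℝ → Matrix (Fin p) (Fin p) ℂ} (h : BoundedMaxEig f)
    (hH : ∀ᵐ θ ∂freqMeasure, (f θ).IsHermitian) {J : Finset (Fin p)} (hJ : J.Nonempty) :
    BoundedMaxEig (subDensity f J) := by
  obtain ⟨C, hC⟩ := h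
  refine ⟨C, ?_⟩
  have := hJ.to_subtype
  filter_upwards [hC, hH] with θ h1 h2
  exact (maxEig_submatrix_le h2 Subtype.val_injective).trans h1

lemma realForm_submatrix {p : ℕ} (A : Matrix (Fin p) (Fin p) ℂ) {J : Finset (Fin p)}
    {x : Fin p → ℝ} (hx : ∀ j ∉ J, x j = 0) :
    realForm (A.submatrix (fun i : J => (i : Fin p)) (fun i : J => (i : Fin p)))
      (fun i : J => x i) = realForm A x := by
  simp only [realForm, Matrix.submatrix_apply]
  rw [Finset.sum_coe_sort J (fun i => ∑ j : J, (x i : ℂ) * x j * A i j)]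
  rw [← Finset.sum_subset (Finset.subset_univ J) (fun i _ hi => by simp [hx i hi])]
  refine Finset.sum_congr rfl fun i _ => ?_
  rw [Finset.sum_coe_sort J (fun j => (x i : ℂ) * x j * A i j)]
  exact Finset.sum_subset (Finset.subset_univ J) (fun i _ hi => by simp [hx i hi])

/-- The Hermitian form of the spectral density at a sparse vector is bounded by `M(f, k)`. -/
lemma ae_realForm_le_stabMk {p k : ℕ} {f : ℝ → Matrix (Fin p) (Fin p) ℂ} (h : BoundedMaxEig f)
    (hH : ∀ᵐ θ ∂freqMeasure, (f θ).IsHermitian) {J : Finset (Fin p)} (hJ : J.card ≤ k)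
    {x : Fin p → ℝ} (hx : ∀ j ∉ J, x j = 0) :
    ∀ᵐ θ ∂freqMeasure, (realForm (f θ) x).re ≤ stabMk f k * ∑ i, x i ^ 2 := by
  rcases J.eq_empty_or_nonempty with rfl | hne
  · have : x = 0 := by ext j; simpa using hx j
    subst this
    simp [realForm]
  have h1 : stabM (subDensity f J) ≤ stabMk f k :=
    le_ciSup (f := fun J : {J : Finset (Fin p) // J.Nonempty ∧ J.card ≤ k} =>
      stabM (subDensity f J.1)) (Set.finite_range _).bddAbove ⟨J, hne, hJ⟩
  filter_upwards [hH, ae_maxEig_le_stabM (h.subDensity hH hne)] with θ h2 h3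
  have h4 := (realForm_re_le_of_isHermitian
    (h2.submatrix (fun i : J => (i : Fin p))) (fun i : J => x i)).1
  rw [realForm_submatrix _ hx, Finset.sum_coe_sort J (fun i => x i ^ 2),
    Finset.sum_subset (Finset.subset_univ J) (fun i _ hi => by simp [hx i hi])] at h4
  refine h4.trans ?_
  have : maxEig (subDensity f J θ) ≤ stabMk f k := h3.trans h1
  exact mul_le_mul_of_nonneg_right this (by positivity)

lemma realForm_add_add_sub {ι : Type*} [Fintype ι] (A : Matrix ι ι ℂ) (y z : ι → ℝ) :
    realForm A (y + z) + realForm A (y - z) = 2 * (realForm A y + realForm A z) := by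
  simp only [realForm, ← Finset.sum_add_distrib, Finset.mul_sum]
  refine Finset.sum_congr rfl fun i _ => Finset.sum_congr rfl fun j _ => ?_
  simp only [Pi.add_apply, Pi.sub_apply]
  push_cast; ring

lemma ae_realForm_ge_stabm {p : ℕ} {f : ℝ → Matrix (Fin p) (Fin p) ℂ}
    (hH : ∀ᵐ θ ∂freqMeasure, (f θ).IsHermitian) (hm : 0 < stabm f) (x : Fin p → ℝ) :
    ∀ᵐ θ ∂freqMeasure, stabm f * ∑ i, x i ^ 2 ≤ (realForm (f θ) x).re := by
  filter_upwards [hH, ae_stabm_le_minEig hm] with θ h1 h2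
  exact (mul_le_mul_of_nonneg_right h2 (by positivity)).trans
    (realForm_re_le_of_isHermitian h1 x).2

/-- Maurey's method tests `2k`-sparse vectors, whereas only `M(f, k)` is available. Split `x` into
two `k`-sparse pieces `y`, `z`; the parallelogram law and nonnegativity of the form at `y - z` cost
a factor 2. -/
lemma ae_realForm_le_two_mul_stabMk {p k : ℕ} {f : ℝ → Matrix (Fin p) (Fin p) ℂ}
    (h : BoundedMaxEig f) (hH : ∀ᵐ θ ∂freqMeasure, (f θ).IsHermitian) (hm : 0 < stabm f)
    {x : Fin p → ℝ} (hx : (Finset.univ.filter fun j => x j ≠ 0).card ≤ 2 * k) :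
    ∀ᵐ θ ∂freqMeasure, (realForm (f θ) x).re ≤ 2 * stabMk f k * ∑ i, x i ^ 2 := by
  set S := Finset.univ.filter fun j => x j ≠ 0 with hS
  obtain ⟨T, hTS, hT⟩ := Finset.exists_subset_card_eq (s := S) (n := min k S.card)
    (min_le_right _ _)
  let y : Fin p → ℝ := fun j => if j ∈ T then x j else 0
  let z : Fin p → ℝ := fun j => if j ∈ T then 0 else x j
  have hxyz : x = y + z := by
    ext j; simp only [y, z, Pi.add_apply]; split_ifs <;> simp
  have hsum : ∑ i, x i ^ 2 = ∑ i, y i ^ 2 + ∑ i, z i ^ 2 := by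
    rw [← Finset.sum_add_distrib]
    refine Finset.sum_congr rfl fun j _ => ?_
    simp only [y, z]; split_ifs <;> simp
  have hy := ae_realForm_le_stabMk (k := k) h hH (J := T) (x := y) (by omega)
    (fun j hj => by simp [y, hj])
  have hz := ae_realForm_le_stabMk (k := k) h hH (J := S \ T) (x := z)
    (by rw [Finset.card_sdiff_of_subset hTS]; omega)
    (fun j hj => by
      simp only [Finset.mem_sdiff, not_and, not_not, hS, Finset.mem_filter, Finset.mem_univ,
        true_and] at hj
      simp only [z]
      split_ifs with hjT
      · rfl
      · by_contra h0
        exact hjT (hj h0))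
  filter_upwards [hy, hz, ae_realForm_ge_stabm hH hm (y - z)] with θ h1 h2 h3
  have h4 := congrArg Complex.re (realForm_add_add_sub (f θ) y z)
  rw [← hxyz] at h4
  have h5 : 0 ≤ stabm f * ∑ i, (y - z) i ^ 2 := by positivity
  simp only [Complex.add_re, Complex.mul_re, Complex.re_ofNat, Complex.im_ofNat] at h4
  rw [hsum]
  linarith

lemma integrable_realForm {ι : Type*} [Fintype ι] {Γ : ℤ → Matrix ι ι ℝ}
    {f : ℝ → Matrix ι ι ℂ} (h : IsSpectralDensity Γ f) (x : ι → ℝ) :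
    Integrable (fun θ => realForm (f θ) x) freqMeasure := by
  simp only [realForm]
  exact integrable_finsetSum _ fun i _ => integrable_finsetSum _ fun j _ =>
    ((h.memLp i j).integrable (by norm_num)).const_mul _

lemma integrable_mul_exp {φ : ℝ → ℂ} (hφ : Integrable φ freqMeasure) (l : ℤ) :
    Integrable (fun θ => φ θ * Complex.exp (Complex.I * l * θ)) freqMeasure :=
  hφ.mul_bdd (c := 1)
    (by fun_prop : Continuous fun θ : ℝ => Complex.exp (Complex.I * l * θ)).aestronglyMeasurable
    (ae_of_all _ fun θ => (norm_exp_I_mul_int_mul l θ).le)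

lemma integral_realForm_mul_exp {ι : Type*} [Fintype ι] {Γ : ℤ → Matrix ι ι ℝ}
    {f : ℝ → Matrix ι ι ℂ} (h : IsSpectralDensity Γ f) (x : ι → ℝ) (l : ℤ) :
    ∫ θ, realForm (f θ) x * Complex.exp (Complex.I * l * θ) ∂freqMeasure =
      ((∑ i, ∑ j, x i * x j * Γ l i j : ℝ) : ℂ) := by
  have hint : ∀ i j, Integrable (fun θ => ((x i : ℂ) * x j) *
      (f θ i j * Complex.exp (Complex.I * l * θ))) freqMeasure := fun i j =>
    (integrable_mul_exp ((h.memLp i j).integrable (by norm_num)) l).const_mul _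
  have : ∀ θ : ℝ, realForm (f θ) x * Complex.exp (Complex.I * l * θ) =
      ∑ i, ∑ j, ((x i : ℂ) * x j) * (f θ i j * Complex.exp (Complex.I * l * θ)) := by
    intro θ
    simp only [realForm, Finset.sum_mul]
    refine Finset.sum_congr rfl fun i _ => Finset.sum_congr rfl fun j _ => by ring
  simp only [this]
  rw [integral_finsetSum _ fun i _ => integrable_finsetSum _ fun j _ => hint i j]
  push_cast
  refine Finset.sum_congr rfl fun i _ => ?_
  rw [integral_finsetSum _ fun j _ => hint i j]
  refine Finset.sum_congr rfl fun j _ => ?_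
  rw [integral_const_mul, h.integral_mul_exp]

/-! ### Toeplitz forms and their symbols. -/

/-- The trigonometric polynomial `∑ a_r e^{i t_r θ}`. -/
noncomputable def trigPoly {n : ℕ} (t : Fin n → ℤ) (a : Fin n → ℝ) (θ : ℝ) : ℂ :=
  ∑ r, (a r : ℂ) * Complex.exp (Complex.I * t r * θ)

lemma normSq_trigPoly {n : ℕ} (t : Fin n → ℤ) (a : Fin n → ℝ) (θ : ℝ) :
    ((Complex.normSq (trigPoly t a θ) : ℝ) : ℂ) =
      ∑ r, ∑ s, (a r * a s : ℂ) * Complex.exp (Complex.I * (t s - t r : ℤ) * θ) := by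
  rw [Complex.normSq_eq_conj_mul_self, trigPoly, map_sum, Finset.sum_mul_sum]
  refine Finset.sum_congr rfl fun r _ => Finset.sum_congr rfl fun s _ => ?_
  have : Complex.exp (Complex.I * (t s - t r : ℤ) * θ) =
      Complex.exp (-Complex.I * t r * θ) * Complex.exp (Complex.I * t s * θ) := by
    rw [← Complex.exp_add]
    congr 1
    push_cast; ring
  rw [this, map_mul, Complex.conj_ofReal, ← Complex.exp_conj]
  simp only [map_mul, Complex.conj_I, Complex.conj_ofReal, map_intCast]
  ring

/-- Expanding `|∑ a_r e^{i t_r θ}|²` turns the integral against the symbol into Fourier coefficients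
at the lags `t_s - t_r`. The weight is nonnegative, so bounds on the symbol carry over to the form.
-/
lemma sum_sum_toeplitz_eq {n : ℕ} (t : Fin n → ℤ) (a : Fin n → ℝ) {φ : ℝ → ℂ} {γ : ℤ → ℝ}
    (hφ : Integrable φ freqMeasure)
    (hγ : ∀ l : ℤ, ∫ θ, φ θ * Complex.exp (Complex.I * l * θ) ∂freqMeasure = γ l) :
    Integrable (fun θ => Complex.normSq (trigPoly t a θ) * (φ θ).re) freqMeasure ∧
    ∑ r, ∑ s, a r * a s * γ (t s - t r) =
      ∫ θ, Complex.normSq (trigPoly t a θ) * (φ θ).re ∂freqMeasure := by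
  have hint : ∀ r s, Integrable (fun θ : ℝ => ((a r : ℂ) * a s) *
      (φ θ * Complex.exp (Complex.I * (t s - t r : ℤ) * θ))) freqMeasure :=
    fun r s => (integrable_mul_exp hφ _).const_mul _
  have hpt : ∀ θ : ℝ, (Complex.normSq (trigPoly t a θ) : ℂ) * φ θ =
      ∑ r, ∑ s, ((a r : ℂ) * a s) * (φ θ * Complex.exp (Complex.I * (t s - t r : ℤ) * θ)) := by
    intro θ
    rw [normSq_trigPoly]
    simp only [Finset.sum_mul]
    refine Finset.sum_congr rfl fun i _ => Finset.sum_congr rfl fun j _ => by ring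
  have hI : Integrable (fun θ => (Complex.normSq (trigPoly t a θ) : ℂ) * φ θ) freqMeasure := by
    simp only [hpt]
    exact integrable_finsetSum _ fun r _ => integrable_finsetSum _ fun s _ => hint r s
  have hre : ∀ θ, ((Complex.normSq (trigPoly t a θ) : ℂ) * φ θ).re =
      Complex.normSq (trigPoly t a θ) * (φ θ).re := fun θ => Complex.re_ofReal_mul _ _
  constructor
  · have := hI.re
    simpa only [RCLike.re_eq_complex_re, hre] using this
  · have h1 : ∫ θ, (Complex.normSq (trigPoly t a θ) : ℂ) * φ θ ∂freqMeasure =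
        ((∑ r, ∑ s, a r * a s * γ (t s - t r) : ℝ) : ℂ) := by
      simp only [hpt]
      rw [integral_finsetSum _ fun i _ => integrable_finsetSum _ fun j _ => hint i j,
        Complex.ofReal_sum]
      refine Finset.sum_congr rfl fun i _ => ?_
      rw [Complex.ofReal_sum]
      rw [integral_finsetSum _ fun j _ => hint i j]
      refine Finset.sum_congr rfl fun j _ => ?_
      rw [integral_const_mul, hγ]
      push_cast; ring
    have h2 := integral_re hI
    simp only [RCLike.re_eq_complex_re, hre] at h2
    rw [h2, h1, Complex.ofReal_re]

/-- A Toeplitz form is bounded by `2π` times the essential supremum of its symbol. -/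
lemma sum_sum_toeplitz_le {n : ℕ} {t : Fin n → ℤ} (ht : Function.Injective t) (a : Fin n → ℝ)
    {φ : ℝ → ℂ} {γ : ℤ → ℝ} (hφ : Integrable φ freqMeasure)
    (hγ : ∀ l : ℤ, ∫ θ, φ θ * Complex.exp (Complex.I * l * θ) ∂freqMeasure = γ l) {M : ℝ}
    (hM : ∀ᵐ θ ∂freqMeasure, (φ θ).re ≤ M) :
    ∑ r, ∑ s, a r * a s * γ (t s - t r) ≤ 2 * Real.pi * M * ∑ r, a r ^ 2 := by
  obtain ⟨h1, h2⟩ := sum_sum_toeplitz_eq t a hφ hγ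
  -- Comparison with the constant symbol `M`, whose Toeplitz matrix is `2πM` times the identity
  -- because the sample times are distinct.
  obtain ⟨h3, h4⟩ := sum_sum_toeplitz_eq t a (φ := fun _ => (M : ℂ))
    (γ := fun l => if l = 0 then 2 * Real.pi * M else 0) (integrable_const _) (fun l => by
      rw [integral_const_mul, integral_freqMeasure_exp]
      split_ifs <;> push_cast <;> ring)
  rw [h2]
  calc _ ≤ ∫ θ, Complex.normSq (trigPoly t a θ) * ((M : ℂ)).re ∂freqMeasure := by
        refine integral_mono_ae h1 h3 ?_
        filter_upwards [hM] with θ hθ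
        exact mul_le_mul_of_nonneg_left (by simpa using hθ) (Complex.normSq_nonneg _)
    _ = _ := by
        rw [← h4, Finset.mul_sum]
        refine Finset.sum_congr rfl fun r _ => ?_
        simp only [sub_eq_zero, ht.eq_iff]
        simp
        ring

lemma le_toeplitz_zero {φ : ℝ → ℂ} {γ : ℤ → ℝ} (hφ : Integrable φ freqMeasure)
    (hγ : ∀ l : ℤ, ∫ θ, φ θ * Complex.exp (Complex.I * l * θ) ∂freqMeasure = γ l) {m : ℝ}
    (hm : ∀ᵐ θ ∂freqMeasure, m ≤ (φ θ).re) : 2 * Real.pi * m ≤ γ 0 := by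
  have h0 := hγ 0
  simp only [Int.cast_zero, mul_zero, zero_mul, Complex.exp_zero, mul_one] at h0
  have h1 := integral_re hφ
  rw [h0] at h1
  simp only [RCLike.re_eq_complex_re, Complex.ofReal_re] at h1
  rw [← h1]
  calc 2 * Real.pi * m = ∫ _, m ∂freqMeasure := by
        simp [freqMeasure, Measure.real, Real.volume_Icc]
        rw [ENNReal.toReal_ofReal (by linarith [Real.pi_pos])]
        left; ring
    _ ≤ _ := integral_mono_ae (integrable_const _) hφ.re hm

/-! ### Covariances of one-dimensional projections of a process. -/

section Projection

variable {Ω ι : Type*} [MeasurableSpace Ω] [Fintype ι] {μ : Measure Ω}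
  {X : ℤ → Ω → EuclideanSpace ℝ ι}

lemma IsStationaryGaussian.hasGaussianLaw_comp (hX : IsStationaryGaussian X μ) {n : ℕ}
    (t : Fin n → ℤ) : HasGaussianLaw (fun ω r => X (t r) ω) μ := by
  have h := hX.gaussian.hasGaussianLaw (Finset.univ.image t)
  exact h.map_fun (F := Fin n → EuclideanSpace ℝ ι)
    (ContinuousLinearMap.pi fun r => ContinuousLinearMap.proj ⟨t r, by simp⟩)

lemma IsStationaryGaussian.memLp (hX : IsStationaryGaussian X μ) (t : ℤ) (j : ι) :
    MemLp (fun ω => X t ω j) 2 μ :=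
  ((hX.gaussian.hasGaussianLaw_eval t).map_fun (EuclideanSpace.proj (𝕜 := ℝ) j)).memLp_two

lemma IsStationaryGaussian.autocov_neg (hX : IsStationaryGaussian X μ) (l : ℤ) (i j : ι) :
    autocov X μ (-l) i j = autocov X μ l j i := by
  rw [← hX.stationary (-l) l j i, covariance_comm, neg_add_cancel]
  rfl

/-- The one-dimensional projection `⟨x, X^t⟩` of a process. -/
def proj (X : ℤ → Ω → EuclideanSpace ℝ ι) (x : ι → ℝ) (t : ℤ) (ω : Ω) : ℝ :=
  ∑ j, x j * X t ω j

lemma IsStationaryGaussian.memLp_proj (hX : IsStationaryGaussian X μ) (x : ι → ℝ) (t : ℤ) :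
    MemLp (proj X x t) 2 μ :=
  memLp_finsetSum _ fun j _ => (hX.memLp t j).const_mul _

lemma IsStationaryGaussian.hasGaussianLaw_proj (hX : IsStationaryGaussian X μ) {n : ℕ}
    (t : Fin n → ℤ) (x : ι → ℝ) : HasGaussianLaw (fun ω r => proj X x (t r) ω) μ := by
  have h := (hX.hasGaussianLaw_comp t).map_fun (F := Fin n → ℝ)
    (ContinuousLinearMap.pi fun r => (∑ j, x j • EuclideanSpace.proj (𝕜 := ℝ) j) ∘L
      ContinuousLinearMap.proj r)
  convert! h using 3 with ω r
  simp [proj]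

variable [IsProbabilityMeasure μ]

lemma IsStationaryGaussian.integral_proj (hX : IsStationaryGaussian X μ) (x : ι → ℝ) (t : ℤ) :
    ∫ ω, proj X x t ω ∂μ = 0 := by
  simp only [proj]
  rw [integral_finsetSum _ fun j _ => ((hX.memLp t j).integrable (by norm_num)).const_mul _]
  simp [integral_const_mul, hX.centered]

lemma IsStationaryGaussian.covariance_proj (hX : IsStationaryGaussian X μ) (x : ι → ℝ)
    (s t : ℤ) :
    cov[proj X x s, proj X x t; μ] = ∑ i, ∑ j, x i * x j * autocov X μ (t - s) i j := by
  unfold proj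
  rw [covariance_fun_sum_fun_sum (fun i => (hX.memLp _ i).const_mul _)
    (fun i => (hX.memLp _ i).const_mul _)]
  refine Finset.sum_congr rfl fun i _ => Finset.sum_congr rfl fun j _ => ?_
  rw [covariance_const_mul_left, covariance_const_mul_right, ← hX.stationary s (t - s) i j,
    add_sub_cancel]
  ring

lemma IsStationaryGaussian.variance_proj (hX : IsStationaryGaussian X μ) (x : ι → ℝ) (t : ℤ) :
    Var[proj X x t; μ] = ∑ i, ∑ j, x i * x j * autocov X μ 0 i j := by
  rw [← covariance_self (hX.memLp_proj x t).aemeasurable, hX.covariance_proj, sub_self]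

/-- Supplies the covariance bound `K = 2πM` that the Gaussian tail bounds require. -/
lemma IsStationaryGaussian.variance_sum_le (hX : IsStationaryGaussian X μ)
    {f : ℝ → Matrix ι ι ℂ} (hf : IsSpectralDensity (autocov X μ) f) {x : ι → ℝ} {M : ℝ}
    (hM : ∀ᵐ θ ∂freqMeasure, (realForm (f θ) x).re ≤ M) {n : ℕ} {t : Fin n → ℤ}
    (ht : Function.Injective t) (a : Fin n → ℝ) :
    Var[fun ω => ∑ r, a r * proj X x (t r) ω; μ] ≤ 2 * Real.pi * M * ∑ r, a r ^ 2 := by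
  have hL : ∀ r, MemLp (fun ω => a r * proj X x (t r) ω) 2 μ :=
    fun r => (hX.memLp_proj x (t r)).const_mul _
  rw [← covariance_self (memLp_finsetSum _ fun r _ => hL r).aemeasurable,
    covariance_fun_sum_fun_sum hL hL]
  refine le_trans (le_of_eq ?_) (sum_sum_toeplitz_le ht a (integrable_realForm hf x)
    (integral_realForm_mul_exp hf x) hM)
  refine Finset.sum_congr rfl fun i _ => Finset.sum_congr rfl fun j _ => ?_
  rw [covariance_const_mul_left, covariance_const_mul_right]
  rw [hX.covariance_proj]
  ring

lemma IsStationaryGaussian.le_variance_proj (hX : IsStationaryGaussian X μ)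
    {f : ℝ → Matrix ι ι ℂ} (hf : IsSpectralDensity (autocov X μ) f) {x : ι → ℝ} {m : ℝ}
    (hm : ∀ᵐ θ ∂freqMeasure, m ≤ (realForm (f θ) x).re) (t : ℤ) :
    2 * Real.pi * m ≤ Var[proj X x t; μ] := by
  rw [hX.variance_proj]
  exact le_toeplitz_zero (γ := fun l => ∑ i, ∑ j, x i * x j * autocov X μ l i j)
    (integrable_realForm hf x) (integral_realForm_mul_exp hf x) hm

end Projection

/-! ### Maurey's empirical method and restricted eigenvalues. -/

/-- If a quadratic form is nonnegative at all `s`-fold sums of the vectors `a j`, then it satisfies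
the inequality obtained by averaging over independent draws with `∑ w j • a j = v`. -/
lemma quadraticForm_average_nonneg {V ι : Type*} [AddCommGroup V] [Module ℝ V] [Fintype ι]
    (Q : QuadraticForm ℝ V) (a : ι → V) {w : ι → ℝ} (hw : ∀ j, 0 ≤ w j) (hw1 : ∑ j, w j = 1)
    {v : V} (hv : ∑ j, w j • a j = v) (s : ℕ) :
    ∀ y : V, (∀ J : Fin s → ι, 0 ≤ Q (y + ∑ i, a (J i))) →
      0 ≤ Q (y + (s : ℝ) • v) + s * (∑ j, w j * Q (a j) - Q v) := by
  -- One draw: the cross term is linear in the draw, so its mean is the cross term at `v`; only the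
  -- variance-like excess `∑ w j * Q (a j) - Q v` remains. The induction on `s`, with `y` free to
  -- absorb earlier draws, adds one excess per draw.
  have havg : ∀ u : V, ∑ j, w j * Q (u + a j) = Q (u + v) + (∑ j, w j * Q (a j) - Q v) := by
    intro u
    have h1 : ∑ j, w j * QuadraticMap.polar Q u (a j) = QuadraticMap.polar Q u v := by
      rw [← hv]
      change _ = QuadraticMap.polarBilin Q u (∑ j, w j • a j)
      rw [map_sum]
      exact Finset.sum_congr rfl fun j _ => by rw [map_smul]; rfl
    simp only [QuadraticMap.map_add Q, mul_add, Finset.sum_add_distrib, ← Finset.sum_mul, hw1, h1]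
    ring
  induction s with
  | zero => intro y h; simpa using h Fin.elim0
  | succ s ih =>
    intro y h
    have h1 : ∀ j, 0 ≤ Q (y + a j + (s : ℝ) • v) + s * (∑ j, w j * Q (a j) - Q v) := by
      intro j
      refine ih (y + a j) fun J => ?_
      have := h (Fin.cons j J)
      rw [Fin.sum_univ_succ] at this
      simpa [add_assoc] using this
    have h2 : 0 ≤ ∑ j, w j * (Q (y + a j + (s : ℝ) • v) + s * (∑ j, w j * Q (a j) - Q v)) :=
      Finset.sum_nonneg fun j _ => mul_nonneg (hw j) (h1 j)
    have hcomm : ∀ j, y + a j + (s : ℝ) • v = y + (s : ℝ) • v + a j :=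
      fun j => add_right_comm _ _ _
    simp only [hcomm] at h2
    simp only [mul_add, Finset.sum_add_distrib, ← Finset.sum_mul, hw1] at h2
    rw [havg] at h2
    have e : y + ((s + 1 : ℕ) : ℝ) • v = y + (s : ℝ) • v + v := by
      push_cast; rw [add_smul, one_smul, add_assoc]
    rw [e]
    push_cast
    linarith

/-- The signed standard basis vectors. -/
def signedBasis {p : ℕ} (c : Fin p × Bool) : Fin p → ℝ := Pi.single c.1 (if c.2 then 1 else -1)

/-- Draw `L sign(v_j) e_j` with probability `|v_j| / L`, where `L = ‖v‖₁`; the mean is `v`.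
Homogeneity removes `L`, so the hypothesis concerns a finite family independent of `v`. The average
gives `s² Q v + s (L² D - Q v) ≥ 0`; divide by `s`. -/
lemma quadraticForm_lower_bound {p s : ℕ} (Q : QuadraticForm ℝ (Fin p → ℝ)) (hs : 0 < s)
    (hQ : ∀ J : Fin s → Fin p × Bool, 0 ≤ Q (∑ i, signedBasis (J i))) {D : ℝ}
    (hD : ∀ j, Q (Pi.single j 1) ≤ D) (v : Fin p → ℝ) :
    -((∑ j, |v j|) ^ 2 * D) ≤ (s - 1) * Q v := by
  set L := ∑ j, |v j| with hL
  rcases (Finset.sum_nonneg fun j _ => abs_nonneg (v j) : 0 ≤ L).eq_or_lt with h0 | hpos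
  · have : v = 0 := by
      ext j
      have := (Finset.sum_eq_zero_iff_of_nonneg fun j _ => abs_nonneg (v j)).1 h0.symm j
        (Finset.mem_univ j)
      simpa using this
    rw [show L = 0 from h0.symm, this]
    simp
  have hsign : ∀ j, |v j| * (if 0 ≤ v j then (1 : ℝ) else -1) = v j := by
    intro j
    split_ifs with h
    · rw [abs_of_nonneg h, mul_one]
    · rw [abs_of_neg (not_le.1 h)]; ring
  have hbasis : ∀ j, Q (signedBasis (j, decide (0 ≤ v j))) = Q (Pi.single j 1) := by
    intro j
    by_cases h : 0 ≤ v j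
    · simp [signedBasis, h]
    · simp only [signedBasis, h, decide_false, Bool.false_eq_true, if_false]
      rw [Pi.single_neg, QuadraticMap.map_neg]
  have h1 := quadraticForm_average_nonneg Q
    (fun j => L • signedBasis (j, decide (0 ≤ v j))) (w := fun j => |v j| / L)
    (fun j => by positivity) (by rw [← Finset.sum_div, ← hL, div_self hpos.ne']) (v := v)
    (by
      have : ∀ j, (|v j| / L) • L • signedBasis (j, decide (0 ≤ v j)) = Pi.single j (v j) := by
        intro j
        rw [smul_smul, div_mul_cancel₀ _ hpos.ne', signedBasis, ← Pi.single_smul, smul_eq_mul]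
        simp only [decide_eq_true_eq, hsign]
      simp only [this]
      exact Finset.univ_sum_single v) s 0
    (fun J => by
      rw [zero_add, ← Finset.smul_sum, QuadraticMap.map_smul]
      exact mul_nonneg (by positivity) (hQ fun i => (J i, decide (0 ≤ v (J i)))))
  simp only [zero_add, QuadraticMap.map_smul, hbasis, smul_eq_mul] at h1
  have h2 : ∑ j, |v j| / L * (L * L * Q (Pi.single j 1)) ≤ L ^ 2 * D := by
    calc _ ≤ ∑ j, |v j| / L * (L * L * D) :=
          Finset.sum_le_sum fun j _ => by gcongr; exact hD j
      _ = L ^ 2 * D := by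
          rw [← Finset.sum_mul, ← Finset.sum_div, ← hL, div_self hpos.ne']; ring
  have hs' : (0 : ℝ) < s := by exact_mod_cast hs
  have h3 : 0 ≤ (s : ℝ) * (s * Q v + (L ^ 2 * D - Q v)) := by nlinarith
  have h4 := nonneg_of_mul_nonneg_right h3 hs'
  linarith

lemma sqNorm_nonneg {n : ℕ} (v : Fin n → ℝ) : 0 ≤ sqNorm v :=
  Finset.sum_nonneg fun _ _ => sq_nonneg _

/-- Restricted eigenvalue bound on approximately sparse vectors. -/
lemma restricted_eigenvalue {n p k : ℕ} (hk : 1 ≤ k) (A : Matrix (Fin n) (Fin p) ℝ)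
    (G : Matrix (Fin p) (Fin p) ℝ) {m : ℝ}
    (hG : ∀ v : Fin p → ℝ, 2 * m * ∑ j, v j ^ 2 ≤ ∑ i, ∑ j, v i * v j * G i j)
    (hlow : ∀ J : Fin (2 * k) → Fin p × Bool, let x := ∑ i, signedBasis (J i)
      ∑ i, ∑ j, x i * x j * G i j - m / 33 * ∑ j, x j ^ 2 ≤ (1 / (n : ℝ)) * sqNorm (A.mulVec x))
    (hup : ∀ j, (1 / (n : ℝ)) * sqNorm (A.mulVec (Pi.single j 1)) ≤ G j j + m / 33)
    (hm : 0 ≤ m) (v : Fin p → ℝ) (hv : ∑ j, |v j| ≤ 4 * √k * √(∑ j, v j ^ 2)) :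
    m * ∑ j, v j ^ 2 ≤ (1 / (n : ℝ)) * sqNorm (A.mulVec v) := by
  -- `Q` is the empirical form minus the population form, lifted by `m/33` so that it is nonnegative
  -- at all test vectors.
  let H : Matrix (Fin p) (Fin p) ℝ := (1 / (n : ℝ)) • (A.transpose * A) - G + (m / 33) • 1
  let Q : QuadraticForm ℝ (Fin p → ℝ) := H.toQuadraticForm'
  have hQ : ∀ x : Fin p → ℝ, Q x = (1 / (n : ℝ)) * sqNorm (A.mulVec x) -
      ∑ i, ∑ j, x i * x j * G i j + m / 33 * ∑ j, x j ^ 2 := by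
    intro x
    have e0 : Q x = x ⬝ᵥ H.mulVec x := by
      simp only [Q, Matrix.toQuadraticForm']
      exact Matrix.toLinearMap₂'_apply' H x x
    have e1 : sqNorm (A.mulVec x) = x ⬝ᵥ (A.transpose * A).mulVec x := by
      rw [← Matrix.mulVec_mulVec, Matrix.dotProduct_mulVec, Matrix.vecMul_transpose]
      simp [sqNorm, dotProduct, sq]
    have e2 : ∑ i, ∑ j, x i * x j * G i j = x ⬝ᵥ G.mulVec x := by
      simp only [dotProduct, Matrix.mulVec, Finset.mul_sum]
      exact Finset.sum_congr rfl fun i _ => Finset.sum_congr rfl fun j _ => by ring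
    rw [e0, e1, e2]
    simp only [H, Matrix.add_mulVec, Matrix.sub_mulVec, Matrix.smul_mulVec, Matrix.one_mulVec,
      dotProduct_add, dotProduct_sub, dotProduct_smul, smul_eq_mul]
    simp [dotProduct, sq]
  have hmain := quadraticForm_lower_bound (s := 2 * k) Q (by omega)
    (fun J => by have := hlow J; simp only at this; rw [hQ]; linarith)
    (D := 2 * (m / 33)) (fun j => by
      rw [hQ]
      have h1 : ∑ i, ∑ l, (Pi.single j 1 : Fin p → ℝ) i * (Pi.single j 1 : Fin p → ℝ) l * G i l
          = G j j := by
        simp [Pi.single_apply]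
      have h2 : ∑ i, (Pi.single j 1 : Fin p → ℝ) i ^ 2 = 1 := by
        simp [Pi.single_apply]
      rw [h1, h2]
      have := hup j
      linarith) v
  have hsq : (∑ j, |v j|) ^ 2 ≤ 16 * k * ∑ j, v j ^ 2 := by
    have h0 : 0 ≤ ∑ j, |v j| := Finset.sum_nonneg fun j _ => abs_nonneg (v j)
    calc (∑ j, |v j|) ^ 2 ≤ (4 * √k * √(∑ j, v j ^ 2)) ^ 2 := by gcongr
      _ = _ := by
        rw [mul_pow, mul_pow, Real.sq_sqrt (by positivity), Real.sq_sqrt (by positivity)]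
        norm_num
  rw [hQ] at hmain
  have hGv := hG v
  set N := ∑ j, v j ^ 2
  have hN : 0 ≤ N := Finset.sum_nonneg fun j _ => sq_nonneg _
  push_cast at hmain
  have hk' : (1 : ℝ) ≤ k := by exact_mod_cast hk
  set q := (1 / (n : ℝ)) * sqNorm (A.mulVec v) - ∑ i, ∑ j, v i * v j * G i j + m / 33 * N with hq
  have h5 : (∑ j, |v j|) ^ 2 * (2 * (m / 33)) ≤ 16 * k * N * (2 * (m / 33)) := by gcongr
  -- Since `2k - 1 ≥ k`, dividing `16 k N * 2 (m/33)` by `2k - 1` leaves at most `32 (m/33) N`; this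
  -- is why `2k` draws are used. Together with the lift the loss is `33 (m/33) N = m N`, half of the
  -- population bound.
  have h6 : -(32 * (m / 33) * N) ≤ q := by
    by_contra hcon
    push Not at hcon
    have h7 : 0 ≤ 32 * (m / 33) * N := by positivity
    nlinarith
  linarith

/-! ### Deterministic lasso analysis. -/

/-- Deterministic guarantees for the lasso. -/
lemma lasso_bounds {n p k : ℕ} (A : Matrix (Fin n) (Fin p) ℝ) (Y e : Fin n → ℝ)
    {b bhat : EuclideanSpace ℝ (Fin p)} {lam α : ℝ} (hY : Y = A.mulVec b + e) (hlam : 0 < lam)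
    (hα : 0 < α) (hk : (supp b).card ≤ k)
    (hdev : ∀ j, (1 / (n : ℝ)) * |∑ r, A r j * e r| ≤ lam / 4)
    (hRE : ∀ v : Fin p → ℝ, ∑ j, |v j| ≤ 4 * √k * √(∑ j, v j ^ 2) →
      α * ∑ j, v j ^ 2 ≤ (1 / (n : ℝ)) * sqNorm (A.mulVec v))
    (hsol : IsLassoSolution Y A lam bhat) :
    ‖bhat - b‖ ≤ 2 * lam * √k / α ∧ l1norm (bhat - b) ≤ 8 * lam * k / α ∧
      (1 / (n : ℝ)) * sqNorm (A.mulVec (bhat - b)) ≤ 4 * lam ^ 2 * k / α ∧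
      ((supp (hardThreshold lam bhat) \ supp b).card : ℝ) ≤ 24 * k / α := by
  set v := bhat - b with hv
  have hsol' := hsol b
  have hb : bhat = b + v := by rw [hv]; abel
  have hn0 : 0 ≤ 1 / (n : ℝ) := by positivity
  have hY1 : Y - A.mulVec bhat = e - A.mulVec v := by
    rw [hY, hb]
    simp only [WithLp.ofLp_add, Matrix.mulVec_add]
    abel
  have hY2 : Y - A.mulVec b = e := by rw [hY]; abel
  have hexpand : sqNorm (e - A.mulVec v) =
      sqNorm e + sqNorm (A.mulVec v) - 2 * ∑ j, v j * ∑ r, A r j * e r := by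
    have : ∑ j, v j * ∑ r, A r j * e r = ∑ r, e r * A.mulVec v r := by
      simp only [Matrix.mulVec, dotProduct, Finset.mul_sum]
      rw [Finset.sum_comm]
      exact Finset.sum_congr rfl fun i _ => Finset.sum_congr rfl fun j _ => by ring
    rw [this, Finset.mul_sum]
    simp only [sqNorm, ← Finset.sum_add_distrib, ← Finset.sum_sub_distrib, Pi.sub_apply]
    exact Finset.sum_congr rfl fun i _ => by ring
  have hcross : (1 / (n : ℝ)) * ∑ j, v j * ∑ r, A r j * e r ≤ lam / 4 * ∑ j, |v j| := by
    rw [Finset.mul_sum, Finset.mul_sum]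
    refine Finset.sum_le_sum fun j _ => ?_
    calc _ ≤ |(1 / (n : ℝ)) * (v j * ∑ r, A r j * e r)| := le_abs_self _
      _ = ((1 / (n : ℝ)) * |∑ r, A r j * e r|) * |v j| := by
        rw [abs_mul, abs_mul, abs_of_nonneg hn0]; ring
      _ ≤ _ := mul_le_mul_of_nonneg_right (hdev j) (abs_nonneg _)
  -- The basic inequality: compare the objective at `bhat` and at `b`, and absorb the noise cross
  -- term by `hdev`.
  have hbasic : (1 / (n : ℝ)) * sqNorm (A.mulVec v) ≤
      lam / 2 * ∑ j, |v j| + lam * (∑ j, |b j| - ∑ j, |bhat j|) := by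
    simp only [lassoObj, hY1, hY2, hexpand, l1norm] at hsol'
    have h0 : (1 / (n : ℝ)) * (sqNorm e + sqNorm (A.mulVec v) -
      2 * ∑ j, v j * ∑ r, A r j * e r) = (1 / (n : ℝ)) * sqNorm e +
        (1 / (n : ℝ)) * sqNorm (A.mulVec v) -
        2 * ((1 / (n : ℝ)) * ∑ j, v j * ∑ r, A r j * e r) := by ring
    rw [h0] at hsol'
    linarith
  set S := supp b
  have hsplit : ∑ j, |v j| = ∑ j ∈ S, |v j| + ∑ j ∈ Sᶜ, |v j| :=
    (Finset.sum_add_sum_compl S _).symm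
  have hdec : ∑ j, |b j| - ∑ j, |bhat j| ≤ ∑ j ∈ S, |v j| - ∑ j ∈ Sᶜ, |v j| := by
    rw [← Finset.sum_add_sum_compl S (fun j => |b j|),
      ← Finset.sum_add_sum_compl S (fun j => |bhat j|)]
    have h1 : ∑ j ∈ Sᶜ, |b j| = 0 := by
      refine Finset.sum_eq_zero fun j hj => ?_
      have : b j = 0 := by simpa [S, supp] using hj
      simp [this]
    have h2 : ∑ j ∈ Sᶜ, |bhat j| = ∑ j ∈ Sᶜ, |v j| := by
      refine Finset.sum_congr rfl fun j hj => ?_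
      have : b j = 0 := by simpa [S, supp] using hj
      simp [hv, this]
    have h3 : ∑ j ∈ S, |b j| ≤ ∑ j ∈ S, |bhat j| + ∑ j ∈ S, |v j| := by
      rw [← Finset.sum_add_distrib]
      refine Finset.sum_le_sum fun j _ => ?_
      have : b j = bhat j - v j := by simp [hv]
      rw [this]
      exact abs_sub _ _
    linarith
  set a := ∑ j ∈ S, |v j|
  set c := ∑ j ∈ Sᶜ, |v j|
  have hc0 : 0 ≤ c := Finset.sum_nonneg fun j _ => abs_nonneg _
  have hA0 : 0 ≤ (1 / (n : ℝ)) * sqNorm (A.mulVec v) := mul_nonneg hn0 (sqNorm_nonneg _)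
  have hpred : (1 / (n : ℝ)) * sqNorm (A.mulVec v) ≤ lam * (3 / 2 * a - 1 / 2 * c) := by
    have := mul_le_mul_of_nonneg_left hdec hlam.le
    rw [hsplit] at hbasic
    linarith
  -- Nonnegativity of the prediction error forces the error vector into the cone, which unlocks
  -- `hRE`.
  have hcone : c ≤ 3 * a := by
    have := nonneg_of_mul_nonneg_right (hA0.trans hpred) hlam
    linarith
  have hnorm : ‖v‖ = √(∑ j, v j ^ 2) := by
    rw [EuclideanSpace.norm_eq]; simp
  have hnsq : ∑ j, v j ^ 2 = ‖v‖ ^ 2 := by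
    rw [hnorm, Real.sq_sqrt (Finset.sum_nonneg fun j _ => sq_nonneg _)]
  have ha : a ≤ √k * ‖v‖ := by
    have h1 : a ^ 2 ≤ k * ∑ j, v j ^ 2 := by
      calc a ^ 2 ≤ S.card * ∑ j ∈ S, |v j| ^ 2 := sq_sum_le_card_mul_sum_sq
        _ ≤ k * ∑ j, v j ^ 2 := by
          simp only [sq_abs]
          gcongr
          exact Finset.subset_univ S
    calc a ≤ √(k * ∑ j, v j ^ 2) := Real.le_sqrt_of_sq_le h1
      _ = _ := by rw [Real.sqrt_mul (by positivity), hnorm]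
  have hl1 : ∑ j, |v j| ≤ 4 * √k * ‖v‖ := by rw [hsplit]; linarith
  have hre := hRE v (by rw [← hnorm]; exact hl1)
  rw [hnsq] at hre
  have hsk : 0 ≤ √(k : ℝ) := Real.sqrt_nonneg _
  have hskk : √(k : ℝ) * √k = k := Real.mul_self_sqrt (by positivity)
  have hvn : 0 ≤ ‖v‖ := norm_nonneg v
  have hpred2 : (1 / (n : ℝ)) * sqNorm (A.mulVec v) ≤ 3 / 2 * (lam * √k) * ‖v‖ := by
    nlinarith
  have hlk : 0 ≤ lam * √k := by positivity
  have hvα : α * ‖v‖ ≤ 3 / 2 * (lam * √k) := by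
    rcases hvn.eq_or_lt with h | h
    · rw [← h]; simpa using hlk
    · have : α * ‖v‖ * ‖v‖ ≤ 3 / 2 * (lam * √k) * ‖v‖ := by nlinarith
      exact le_of_mul_le_mul_right this h
  have hv' : ‖v‖ ≤ 3 / 2 * (lam * √k) / α := by rw [le_div_iff₀ hα]; linarith
  have hl1' : ∑ j, |v j| ≤ 6 * lam * k / α := by
    calc _ ≤ 4 * √k * ‖v‖ := hl1
      _ ≤ 4 * √k * (3 / 2 * (lam * √k) / α) := by gcongr
      _ = 6 * lam * (√k * √k) / α := by ring
      _ = _ := by rw [hskk]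
  refine ⟨?_, ?_, ?_, ?_⟩
  · refine hv'.trans ?_
    rw [mul_assoc 2]
    gcongr
    linarith
  · refine hl1'.trans ?_
    gcongr
    norm_num
  · calc _ ≤ 3 / 2 * (lam * √k) * ‖v‖ := hpred2
      _ ≤ 3 / 2 * (lam * √k) * (3 / 2 * (lam * √k) / α) := by gcongr
      _ = 9 / 4 * lam ^ 2 * (√k * √k) / α := by ring
      _ ≤ _ := by rw [hskk]; gcongr; norm_num
  -- Each false positive contributes more than `lam` to `‖v‖₁`, as `b` vanishes there; the `ℓ₁`
  -- bound then counts them and `lam` cancels.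
  · have h1 : ((supp (hardThreshold lam bhat) \ S).card : ℝ) * lam ≤ ∑ j, |v j| := by
      rw [← nsmul_eq_mul, ← Finset.sum_const]
      refine (Finset.sum_le_sum (g := fun j => |v j|) fun j hj => ?_).trans
        (Finset.sum_le_sum_of_subset_of_nonneg (Finset.subset_univ _) fun j _ _ => abs_nonneg _)
      simp only [supp, hardThreshold, S, Finset.mem_sdiff, Finset.mem_filter, Finset.mem_univ,
        true_and, not_not, ne_eq, ite_eq_right_iff, Classical.not_imp] at hj
      simp only [hv, PiLp.sub_apply, hj.2, sub_zero]
      exact hj.1.1.le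
    have h2 : ((supp (hardThreshold lam bhat) \ S).card : ℝ) * lam ≤ 6 * k / α * lam := by
      refine (h1.trans hl1').trans (le_of_eq ?_)
      ring
    refine (le_of_mul_le_mul_right h2 hlam).trans ?_
    gcongr
    norm_num

/-! ### Products of independent Gaussian vectors. -/

section Cross

variable {Ω : Type*} [MeasurableSpace Ω] {μ : Measure Ω} {n : ℕ}
  {U V : Fin n → Ω → ℝ}

/-- Concentration for the inner product of two independent centered Gaussian vectors. -/
lemma measure_abs_sum_mul_gt_le (hU : HasGaussianLaw (fun ω i => U i ω) μ)
    (hV : HasGaussianLaw (fun ω i => V i ω) μ)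
    (hind : IndepFun (fun ω i => U i ω) (fun ω i => V i ω) μ)
    (hU0 : ∀ i, ∫ ω, U i ω ∂μ = 0) (hV0 : ∀ i, ∫ ω, V i ω ∂μ = 0) {K L δ : ℝ}
    (hUK : ∀ a : Fin n → ℝ, Var[fun ω => ∑ i, a i * U i ω; μ] ≤ K * ∑ i, a i ^ 2)
    (hVL : ∀ a : Fin n → ℝ, Var[fun ω => ∑ i, a i * V i ω; μ] ≤ L * ∑ i, a i ^ 2)
    (hKL : 0 < K + L) (hδ : 0 ≤ δ) (hδK : δ ≤ 2 * (K + L)) :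
    μ.real {ω | n * δ / 2 < |∑ i, U i ω * V i ω|} ≤
      4 * Real.exp (-(n * δ ^ 2 / (16 * (K + L) ^ 2))) := by
  have := hU.isProbabilityMeasure
  have hUi : ∀ i, HasGaussianLaw (U i) μ := fun i => hU.eval i
  have hVi : ∀ i, HasGaussianLaw (V i) μ := fun i => hV.eval i
  have hpair := hind.hasGaussianLaw hU hV
  have hP : HasGaussianLaw (fun ω i => U i ω + V i ω) μ := hpair.fun_add
  have hM : HasGaussianLaw (fun ω i => U i ω - V i ω) μ := hpair.fun_sub
  have hP0 : ∀ i, ∫ ω, U i ω + V i ω ∂μ = 0 := fun i => by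
    rw [integral_add (hUi i).integrable (hVi i).integrable, hU0, hV0, add_zero]
  have hM0 : ∀ i, ∫ ω, U i ω - V i ω ∂μ = 0 := fun i => by
    rw [integral_sub (hUi i).integrable (hVi i).integrable, hU0, hV0, sub_zero]
  have hLU : ∀ a : Fin n → ℝ, MemLp (fun ω => ∑ i, a i * U i ω) 2 μ := fun a =>
    memLp_finsetSum _ fun i _ => (hUi i).memLp_two.const_mul _
  have hLV : ∀ a : Fin n → ℝ, MemLp (fun ω => ∑ i, a i * V i ω) 2 μ := fun a =>
    memLp_finsetSum _ fun i _ => (hVi i).memLp_two.const_mul _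
  have hIa : ∀ a : Fin n → ℝ,
      IndepFun (fun ω => ∑ i, a i * U i ω) (fun ω => ∑ i, a i * V i ω) μ := fun a =>
    hind.comp (φ := fun u : Fin n → ℝ => ∑ i, a i * u i)
      (ψ := fun u : Fin n → ℝ => ∑ i, a i * u i) (by fun_prop) (by fun_prop)
  have hPK : ∀ a : Fin n → ℝ, Var[fun ω => ∑ i, a i * (U i ω + V i ω); μ] ≤
      (K + L) * ∑ i, a i ^ 2 := by
    intro a
    simp only [mul_add, Finset.sum_add_distrib]
    have h1 := hUK a
    have h2 := hVL a
    rw [variance_fun_add (hLU a) (hLV a), (hIa a).covariance_eq_zero (hLU a) (hLV a)]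
    linarith
  have hMK : ∀ a : Fin n → ℝ, Var[fun ω => ∑ i, a i * (U i ω - V i ω); μ] ≤
      (K + L) * ∑ i, a i ^ 2 := by
    intro a
    simp only [mul_sub, Finset.sum_sub_distrib]
    have h1 := hUK a
    have h2 := hVL a
    rw [variance_fun_sub (hLU a) (hLV a), (hIa a).covariance_eq_zero (hLU a) (hLV a)]
    linarith
  have hIi : ∀ i, IndepFun (U i) (V i) μ := fun i =>
    hind.comp (φ := fun u : Fin n → ℝ => u i) (ψ := fun u : Fin n → ℝ => u i)
      (by fun_prop) (by fun_prop)
  have hPv : ∀ i, Var[fun ω => U i ω + V i ω; μ] = Var[U i; μ] + Var[V i; μ] := fun i =>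
    (hIi i).variance_add (hUi i).memLp_two (hVi i).memLp_two
  have hMv : ∀ i, Var[fun ω => U i ω - V i ω; μ] = Var[U i; μ] + Var[V i; μ] := fun i => by
    rw [variance_fun_sub (hUi i).memLp_two (hVi i).memLp_two,
      (hIi i).covariance_eq_zero (hUi i).memLp_two (hVi i).memLp_two]
    ring
  have b1 := gaussian_measure_sum_sq_ge_le hP hP0 hKL hPK hδ hδK
  have b2 := gaussian_measure_sum_sq_le_le hP hP0 hKL hPK hδ
  have b3 := gaussian_measure_sum_sq_ge_le hM hM0 hKL hMK hδ hδK
  have b4 := gaussian_measure_sum_sq_le_le hM hM0 hKL hMK hδ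
  simp only [hPv, hMv] at b1 b2 b3 b4
  -- By independence `U + V` and `U - V` have the same expected squared norm `T`, so it cancels in
  -- `4 ∑ UV = |U + V|² - |U - V|²`. Deviations below `nδ` on each side give `|∑ UV| ≤ nδ/2`.
  set T := ∑ i, (Var[U i; μ] + Var[V i; μ])
  have hsub : {ω | n * δ / 2 < |∑ i, U i ω * V i ω|} ⊆
      ({ω | T + n * δ ≤ ∑ i, (U i ω + V i ω) ^ 2} ∪ {ω | ∑ i, (U i ω + V i ω) ^ 2 ≤ T - n * δ}) ∪
      ({ω | T + n * δ ≤ ∑ i, (U i ω - V i ω) ^ 2} ∪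
        {ω | ∑ i, (U i ω - V i ω) ^ 2 ≤ T - n * δ}) := by
    intro ω hω
    have hpol : 4 * ∑ i, U i ω * V i ω =
        ∑ i, (U i ω + V i ω) ^ 2 - ∑ i, (U i ω - V i ω) ^ 2 := by
      rw [Finset.mul_sum, ← Finset.sum_sub_distrib]
      exact Finset.sum_congr rfl fun i _ => by ring
    simp only [Set.mem_ofPred_eq] at hω
    by_contra hcon
    simp only [Set.mem_union, Set.mem_ofPred_eq, not_or, not_le] at hcon
    obtain ⟨⟨h1, h2⟩, h3, h4⟩ := hcon
    refine absurd hω (not_lt.2 (abs_le.2 ⟨?_, ?_⟩)) <;> linarith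
  have hle := measureReal_mono (μ := μ) hsub
  have u1 := measureReal_union_le (μ := μ)
    ({ω | T + n * δ ≤ ∑ i, (U i ω + V i ω) ^ 2} ∪ {ω | ∑ i, (U i ω + V i ω) ^ 2 ≤ T - n * δ})
    ({ω | T + n * δ ≤ ∑ i, (U i ω - V i ω) ^ 2} ∪ {ω | ∑ i, (U i ω - V i ω) ^ 2 ≤ T - n * δ})
  have u2 := measureReal_union_le (μ := μ)
    {ω | T + n * δ ≤ ∑ i, (U i ω + V i ω) ^ 2} {ω | ∑ i, (U i ω + V i ω) ^ 2 ≤ T - n * δ}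
  have u3 := measureReal_union_le (μ := μ)
    {ω | T + n * δ ≤ ∑ i, (U i ω - V i ω) ^ 2} {ω | ∑ i, (U i ω - V i ω) ^ 2 ≤ T - n * δ}
  linarith

end Cross

/-! ### The sample matrices in terms of projections. -/

lemma sqNorm_dataMatrix_mulVec {Ω : Type*} {n p : ℕ} (X : ℤ → Ω → EuclideanSpace ℝ (Fin p))
    (x : Fin p → ℝ) (ω : Ω) :
    sqNorm ((dataMatrix n X ω).mulVec x) = ∑ r : Fin n, proj X x ((n : ℤ) - (r : ℕ)) ω ^ 2 := by
  simp only [sqNorm, Matrix.mulVec, dotProduct, dataMatrix, Matrix.of_apply, proj, mul_comm]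

lemma injective_sampleTime (n : ℕ) : Function.Injective fun r : Fin n => (n : ℤ) - (r : ℕ) := by
  intro r s h
  ext
  simp only at h
  omega

lemma proj_single {Ω : Type*} {p : ℕ} (X : ℤ → Ω → EuclideanSpace ℝ (Fin p)) (j : Fin p) (t : ℤ)
    (ω : Ω) : proj X (Pi.single j 1) t ω = X t ω j := by
  simp [proj, Pi.single_apply]

lemma dataVector_response {Ω : Type*} {n p : ℕ} (b : EuclideanSpace ℝ (Fin p))
    (X : ℤ → Ω → EuclideanSpace ℝ (Fin p)) (e : ℤ → Ω → ℝ) (ω : Ω) :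
    dataVector n (response b X e) ω =
      (dataMatrix n X ω).mulVec b + fun r : Fin n => e ((n : ℤ) - (r : ℕ)) ω := by
  ext r
  simp [dataVector, response, Matrix.mulVec, dotProduct, dataMatrix, PiLp.inner_apply]

lemma card_support_sum_signedBasis_le {p s : ℕ} (J : Fin s → Fin p × Bool) :
    (Finset.univ.filter fun j => (∑ i, signedBasis (J i)) j ≠ 0).card ≤ s := by
  calc _ ≤ (Finset.univ.image fun i => (J i).1).card := by
        refine Finset.card_le_card fun j hj => ?_
        simp only [Finset.mem_filter, Finset.mem_univ, true_and, Finset.sum_apply] at hj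
        obtain ⟨i, -, hi⟩ := Finset.exists_ne_zero_of_sum_ne_zero hj
        simp only [Finset.mem_image, Finset.mem_univ, true_and]
        refine ⟨i, ?_⟩
        by_contra hne
        exact hi (Pi.single_eq_of_ne' hne _)
    _ ≤ s := Finset.card_image_le.trans (by simp)

lemma proj_scalarProcess {Ω : Type*} (ε : ℤ → Ω → ℝ) : proj (scalarProcess ε) (fun _ => 1) = ε := by
  ext t ω
  simp [proj, scalarProcess]

/-! ### Probabilities of the individual bad events. -/

section Events

variable {Ω : Type*} [MeasurableSpace Ω] {μ : Measure Ω} {p n k : ℕ}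
  {X : ℤ → Ω → EuclideanSpace ℝ (Fin p)} {f : ℝ → Matrix (Fin p) (Fin p) ℂ}

/-- Both almost sure bounds on the form at a basis vector hold at a common frequency, since
`freqMeasure` is nonzero. -/
lemma stabm_le_stabMk (hX : IsStationaryGaussian X μ) (hf : IsSpectralDensity (autocov X μ) f)
    (hB : BoundedMaxEig f) (hm : 0 < stabm f) (hp : 1 ≤ p) (hk : 1 ≤ k) :
    stabm f ≤ stabMk f k := by
  have hH := hf.ae_isHermitian hX.autocov_neg
  let j : Fin p := ⟨0, hp⟩
  have h1 := ae_realForm_le_stabMk (k := k) hB hH (J := {j}) (x := Pi.single j 1) (by simpa using hk)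
    (fun i hi => Pi.single_eq_of_ne (by simpa using hi) _)
  have h2 := ae_realForm_ge_stabm hH hm (Pi.single j 1)
  obtain ⟨θ, h3, h4⟩ := (h1.and h2).exists
  have h5 : ∑ i, (Pi.single j 1 : Fin p → ℝ) i ^ 2 = 1 := by simp [Pi.single_apply]
  rw [h5, mul_one] at h3 h4
  exact h4.trans h3

lemma ae_realForm_scalar_le {ε : ℤ → Ω → ℝ} {g : ℝ → Matrix (Fin 1) (Fin 1) ℂ}
    (hε : IsStationaryGaussian (scalarProcess ε) μ)
    (hg : IsSpectralDensity (autocov (scalarProcess ε) μ) g) (hB : BoundedMaxEig g) :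
    ∀ᵐ θ ∂freqMeasure, (realForm (g θ) (fun _ => 1)).re ≤ stabM g := by
  filter_upwards [hg.ae_isHermitian hε.autocov_neg, ae_maxEig_le_stabM hB] with θ h1 h2
  have := (realForm_re_le_of_isHermitian h1 (fun _ => 1)).1
  simp at this
  linarith

variable [IsProbabilityMeasure μ]

/-- Lower deviation of the empirical quadratic form at a `2k`-sparse vector. -/
lemma measure_sparse_lower_le (hX : IsStationaryGaussian X μ)
    (hf : IsSpectralDensity (autocov X μ) f) (hB : BoundedMaxEig f) (hm : 0 < stabm f)
    (hM : 0 < stabMk f k) (x : Fin p → ℝ)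
    (hx : (Finset.univ.filter fun j => x j ≠ 0).card ≤ 2 * k) :
    μ.real {ω | sqNorm ((dataMatrix n X ω).mulVec x) <
        n * (∑ i, ∑ j, x i * x j * autocov X μ 0 i j) -
          n * (Real.pi * stabm f / 33 * ∑ j, x j ^ 2)} ≤
      Real.exp (-(n * (stabm f / stabMk f k) ^ 2 / 278784)) := by
  have hH := hf.ae_isHermitian hX.autocov_neg
  set N := ∑ j, x j ^ 2
  have hN0 : 0 ≤ N := Finset.sum_nonneg fun j _ => sq_nonneg _
  -- Signed basis vectors may cancel, so `x = 0` does occur; it is separated because the tail bound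
  -- needs `K > 0`.
  rcases hN0.eq_or_lt with h0 | hN
  · have hx0 : x = 0 := by
      ext j
      have := (Finset.sum_eq_zero_iff_of_nonneg fun j _ => sq_nonneg (x j)).1 h0.symm j
        (Finset.mem_univ j)
      simpa using this
    rw [← h0, hx0]
    simp [sqNorm, Real.exp_nonneg]
  have hpi := Real.pi_pos
  -- With `K = 4πMN` and `δ = π m N / 33`, the exponent `δ² / (16K²)` is `(m/M)² / (16 (4 · 33)²)`,
  -- and `16 · 132² = 278784`.
  have hK : 0 < 2 * Real.pi * (2 * stabMk f k * N) := by positivity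
  have h1 := gaussian_measure_sum_sq_le_le (n := n)
    (hX.hasGaussianLaw_proj (fun r : Fin n => (n : ℤ) - (r : ℕ)) x)
    (fun r => hX.integral_proj x _) hK
    (fun a => hX.variance_sum_le hf (ae_realForm_le_two_mul_stabMk hB hH hm hx)
      (injective_sampleTime n) a) (δ := Real.pi * stabm f / 33 * N) (by positivity)
  simp only [hX.variance_proj, Finset.sum_const, Finset.card_univ, Fintype.card_fin,
    nsmul_eq_mul] at h1
  refine (measureReal_mono ?_).trans (h1.trans (Real.exp_le_exp.2 (le_of_eq ?_)))
  · intro ω hω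
    simp only [Set.mem_ofPred_eq] at hω ⊢
    rw [sqNorm_dataMatrix_mulVec] at hω
    exact hω.le
  · field_simp
    ring

/-- Upper deviation of an empirical variance. -/
lemma measure_diag_upper_le (hX : IsStationaryGaussian X μ)
    (hf : IsSpectralDensity (autocov X μ) f) (hB : BoundedMaxEig f) (hm : 0 < stabm f)
    (hM : stabm f ≤ stabMk f k) (hk : 1 ≤ k) (j : Fin p) :
    μ.real {ω | n * autocov X μ 0 j j + n * (Real.pi * stabm f / 33) <
        sqNorm ((dataMatrix n X ω).mulVec (Pi.single j 1))} ≤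
      Real.exp (-(n * (stabm f / stabMk f k) ^ 2 / 278784)) := by
  have hH := hf.ae_isHermitian hX.autocov_neg
  have hpi := Real.pi_pos
  have hM0 : 0 < stabMk f k := hm.trans_le hM
  have h5 : ∑ i, (Pi.single j 1 : Fin p → ℝ) i ^ 2 = 1 := by simp [Pi.single_apply]
  -- The superfluous factor 2 makes the exponent equal to that of the sparse lower bound.
  have hbd : ∀ᵐ θ ∂freqMeasure, (realForm (f θ) (Pi.single j 1)).re ≤ 2 * stabMk f k := by
    have h1 := ae_realForm_le_stabMk (k := k) hB hH (J := {j}) (x := Pi.single j 1)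
      (by simpa using hk) (fun i hi => Pi.single_eq_of_ne (by simpa using hi) _)
    filter_upwards [h1] with θ h
    rw [h5] at h
    linarith
  have hK : 0 < 2 * Real.pi * (2 * stabMk f k) := by positivity
  have h1 := gaussian_measure_sum_sq_ge_le (n := n)
    (hX.hasGaussianLaw_proj (fun r : Fin n => (n : ℤ) - (r : ℕ)) (Pi.single j 1))
    (fun r => hX.integral_proj _ _) hK
    (fun a => hX.variance_sum_le hf hbd (injective_sampleTime n) a)
    (δ := Real.pi * stabm f / 33) (by positivity) (by nlinarith)
  have hvar : ∑ i, ∑ l, (Pi.single j 1 : Fin p → ℝ) i * (Pi.single j 1 : Fin p → ℝ) l *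
      autocov X μ 0 i l = autocov X μ 0 j j := by simp [Pi.single_apply]
  simp only [hX.variance_proj, hvar, Finset.sum_const, Finset.card_univ, Fintype.card_fin,
    nsmul_eq_mul] at h1
  refine (measureReal_mono ?_).trans (h1.trans (Real.exp_le_exp.2 (le_of_eq ?_)))
  · intro ω hω
    simp only [Set.mem_ofPred_eq] at hω ⊢
    rw [sqNorm_dataMatrix_mulVec] at hω
    exact hω.le
  · field_simp
    ring

/-- The variance of a single noise variable is at most `2π` times this quantity. -/
lemma IsStationaryGaussian.stabM_nonneg {ε : ℤ → Ω → ℝ} {g : ℝ → Matrix (Fin 1) (Fin 1) ℂ}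
    (hε : IsStationaryGaussian (scalarProcess ε) μ)
    (hg : IsSpectralDensity (autocov (scalarProcess ε) μ) g) (hB : BoundedMaxEig g) :
    0 ≤ stabM g := by
  have h := hε.variance_sum_le hg (ae_realForm_scalar_le hε hg hB) (injective_sampleTime 1)
    (fun _ => 1)
  have h2 := (variance_nonneg _ _).trans h
  simp only [Finset.univ_unique, Finset.sum_singleton, one_pow, mul_one] at h2
  exact nonneg_of_mul_nonneg_right h2 (by positivity)

/-- Deviation of the inner product between a predictor and the noise. -/
lemma measure_noise_le {ε : ℤ → Ω → ℝ} {g : ℝ → Matrix (Fin 1) (Fin 1) ℂ}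
    (hX : IsStationaryGaussian X μ) (hf : IsSpectralDensity (autocov X μ) f)
    (hB : BoundedMaxEig f) (hε : IsStationaryGaussian (scalarProcess ε) μ)
    (hg : IsSpectralDensity (autocov (scalarProcess ε) μ) g) (hBg : BoundedMaxEig g)
    (hind : IndepFun (fun ω t => X t ω) (fun ω t => ε t ω) μ) (hM : 0 < stabMk f 1) {u : ℝ}
    (hu0 : 0 ≤ u) (hu : u ≤ 2) (j : Fin p) :
    μ.real {ω | n * (2 * Real.pi * (stabMk f 1 + stabM g) * u) / 2 <
        |∑ r, dataMatrix n X ω r j * ε ((n : ℤ) - (r : ℕ)) ω|} ≤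
      4 * Real.exp (-(n * u ^ 2 / 16)) := by
  have hH := hf.ae_isHermitian hX.autocov_neg
  have hpi := Real.pi_pos
  have hg0 := hε.stabM_nonneg hg hBg
  have h5 : ∑ i, (Pi.single j 1 : Fin p → ℝ) i ^ 2 = 1 := by simp [Pi.single_apply]
  have hbd := ae_realForm_le_stabMk (k := 1) hB hH (J := {j}) (x := Pi.single j 1)
      (by simp) (fun i hi => Pi.single_eq_of_ne (by simpa using hi) _)
  rw [h5, mul_one] at hbd
  let t : Fin n → ℤ := fun r => (n : ℤ) - (r : ℕ)
  have hUl := hX.hasGaussianLaw_proj t (Pi.single j 1)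
  have hVl := hε.hasGaussianLaw_proj t (fun _ => 1)
  have hV0 := fun r => hε.integral_proj (fun _ => 1) (t r)
  have hVK := fun a => hε.variance_sum_le hg (ae_realForm_scalar_le hε hg hBg)
    (injective_sampleTime n) a
  simp only [proj_scalarProcess] at hVl hV0 hVK
  have hi : IndepFun (fun ω r => proj X (Pi.single j 1) (t r) ω) (fun ω r => ε (t r) ω) μ := by
    have := hind.comp (φ := fun (x : ℤ → EuclideanSpace ℝ (Fin p)) (r : Fin n) => x (t r) j)
      (ψ := fun (x : ℤ → ℝ) (r : Fin n) => x (t r)) (by fun_prop) (by fun_prop)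
    simpa only [proj_single, Function.comp_def] using this
  have hKL : 0 < 2 * Real.pi * stabMk f 1 + 2 * Real.pi * stabM g := by positivity
  have h := measure_abs_sum_mul_gt_le hUl hVl hi (fun r => hX.integral_proj _ _) hV0
    (fun a => hX.variance_sum_le hf hbd (injective_sampleTime n) a) hVK hKL
    (δ := 2 * Real.pi * (stabMk f 1 + stabM g) * u) (by positivity)
    (by rw [← mul_add, mul_comm 2 (2 * Real.pi * _)]; gcongr)
  simp only [proj_single] at h
  refine h.trans (le_of_eq ?_)
  congr 2
  have : stabMk f 1 + stabM g ≠ 0 := by positivity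
  rw [← mul_add]
  field_simp

end Events

/-! ### Union bound and assembly of the theorem. -/

/-- The union bound over signed sums of `2k` basis vectors and over coordinates. -/
lemma measureReal_iUnion_union_le {Ω : Type*} [MeasurableSpace Ω] {μ : Measure Ω}
    [IsProbabilityMeasure μ] {p k : ℕ} (hp : 2 ≤ p) (hk : 1 ≤ k)
    (A : (Fin (2 * k) → Fin p × Bool) → Set Ω) (D E : Fin p → Set Ω)
    (hA : ∀ J, μ.real (A J) ≤ Real.exp (-(5 * k * Real.log p)))
    (hD : ∀ j, μ.real (D j) ≤ Real.exp (-(5 * k * Real.log p)))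
    (hE : ∀ j, μ.real (E j) ≤ 4 * Real.exp (-(4 * Real.log p))) :
    μ.real ((⋃ J, A J) ∪ ((⋃ j, D j) ∪ ⋃ j, E j)) ≤ 6 * Real.exp (-1 * Real.log p) := by
  have hp0 : (0 : ℝ) < p := by positivity
  have hp2 : (2 : ℝ) ≤ p := by exact_mod_cast hp
  have hk1 : (1 : ℝ) ≤ k := by exact_mod_cast hk
  have hl : 0 ≤ Real.log p := Real.log_nonneg (by linarith)
  have hexp : (p : ℝ) = Real.exp (Real.log p) := (Real.exp_log hp0).symm
  have h1 : μ.real (⋃ J, A J) ≤ Real.exp (-1 * Real.log p) := by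
    calc _ ≤ ∑ J, μ.real (A J) := measureReal_iUnion_fintype_le _
      _ ≤ ∑ _J : Fin (2 * k) → Fin p × Bool, Real.exp (-(5 * k * Real.log p)) :=
        Finset.sum_le_sum fun J _ => hA J
      _ = (p * 2 : ℝ) ^ (2 * k) * Real.exp (-(5 * k * Real.log p)) := by simp
      -- Since `p ≥ 2`, the family has at most `p^(4k)` members; the exponent `5k log p` leaves
      -- `p^(-k)`.
      _ ≤ (p * p : ℝ) ^ (2 * k) * Real.exp (-(5 * k * Real.log p)) := by gcongr
      _ = Real.exp (4 * k * Real.log p) * Real.exp (-(5 * k * Real.log p)) := by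
        congr 1
        rw [hexp, ← Real.exp_add, ← Real.exp_nat_mul, Real.log_exp]
        congr 1
        push_cast; ring
      _ ≤ _ := by
        rw [← Real.exp_add]
        refine Real.exp_le_exp.2 ?_
        nlinarith
  have h2 : μ.real (⋃ j, D j) ≤ Real.exp (-1 * Real.log p) := by
    calc _ ≤ ∑ j, μ.real (D j) := measureReal_iUnion_fintype_le _
      _ ≤ ∑ _j : Fin p, Real.exp (-(5 * k * Real.log p)) := Finset.sum_le_sum fun j _ => hD j
      _ = Real.exp (Real.log p) * Real.exp (-(5 * k * Real.log p)) := by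
        rw [← hexp]; simp
      _ ≤ _ := by
        rw [← Real.exp_add]
        refine Real.exp_le_exp.2 ?_
        nlinarith
  have h3 : μ.real (⋃ j, E j) ≤ 4 * Real.exp (-1 * Real.log p) := by
    calc _ ≤ ∑ j, μ.real (E j) := measureReal_iUnion_fintype_le _
      _ ≤ ∑ _j : Fin p, 4 * Real.exp (-(4 * Real.log p)) := Finset.sum_le_sum fun j _ => hE j
      _ = 4 * (Real.exp (Real.log p) * Real.exp (-(4 * Real.log p))) := by
        rw [← hexp]; simp; ring
      _ ≤ _ := by
        rw [← Real.exp_add]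
        gcongr
        linarith
  have u1 := measureReal_union_le (μ := μ) (⋃ J, A J) ((⋃ j, D j) ∪ ⋃ j, E j)
  have u2 := measureReal_union_le (μ := μ) (⋃ j, D j) (⋃ j, E j)
  linarith

end StochReg

theorem proposition3p3 :
    ∃ C c₀ c₁ c₂ : ℝ, 0 < C ∧ 0 < c₀ ∧ 0 < c₁ ∧ 0 < c₂ ∧
    ∀ (n p k : ℕ), 1 ≤ n → 1 ≤ p → 1 ≤ k →
    ∀ {Ω : Type*} [MeasurableSpace Ω] (μ : Measure Ω) [IsProbabilityMeasure μ]
      (X : ℤ → Ω → EuclideanSpace ℝ (Fin p)) (ε : ℤ → Ω → ℝ)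
      (fX : ℝ → Matrix (Fin p) (Fin p) ℂ) (fε : ℝ → Matrix (Fin 1) (Fin 1) ℂ)
      (βstar : EuclideanSpace ℝ (Fin p)) (lam : ℝ),
    StochReg.IsStationaryGaussian X μ →
    StochReg.IsStationaryGaussian (StochReg.scalarProcess ε) μ →
    IndepFun (fun ω t => X t ω) (fun ω t => ε t ω) μ →
    StochReg.IsSpectralDensity (StochReg.autocov X μ) fX →
    StochReg.IsSpectralDensity (StochReg.autocov (StochReg.scalarProcess ε) μ) fε →
    StochReg.BoundedMaxEig fX →
    StochReg.BoundedMaxEig fε →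
    0 < StochReg.stabm fX →
    (StochReg.supp βstar).card ≤ k →
    C * ((StochReg.stabMk fX k / StochReg.stabm fX) ^ 2 * k * Real.log p) ≤ n →
    c₀ * (2 * Real.pi) * (StochReg.stabMk fX 1 + StochReg.stabM fε) *
      Real.sqrt (Real.log p / n) ≤ lam →
    ∃ A : Set Ω, MeasurableSet A ∧ 1 - c₁ * Real.exp (-c₂ * Real.log p) ≤ μ.real A ∧
      ∀ ω ∈ A, ∀ βhat : EuclideanSpace ℝ (Fin p),
        StochReg.IsLassoSolution (StochReg.dataVector n (StochReg.response βstar X ε) ω)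
          (StochReg.dataMatrix n X ω) lam βhat →
        ‖βhat - βstar‖ ≤ 2 * lam * Real.sqrt k / (Real.pi * StochReg.stabm fX) ∧
        StochReg.l1norm (βhat - βstar) ≤ 8 * lam * k / (Real.pi * StochReg.stabm fX) ∧
        (1 / (n : ℝ)) * StochReg.sqNorm ((StochReg.dataMatrix n X ω).mulVec (βhat - βstar))
          ≤ 4 * lam ^ 2 * k / (Real.pi * StochReg.stabm fX) ∧
        ((StochReg.supp (StochReg.hardThreshold lam βhat) \ StochReg.supp βstar).card : ℝ)
          ≤ 24 * k / (Real.pi * StochReg.stabm fX) := by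

  -- `1393920 = 5 · 278784` makes the exponents `5 k log p`. The constant `16` is twice the `8` in
  -- `u` below, and `6 = 1 + 1 + 4` sums the three unions.
  refine ⟨1393920, 16, 6, 1, by norm_num, by norm_num, by norm_num, by norm_num, ?_⟩
  intro n p k hn hp hk Ω _ μ _ X ε fX fε βstar lam hX hε hind hfX hfε hBX hBε hm hsupp hC hlam
  rcases hp.eq_or_lt with rfl | hp2
  -- For `p = 1` the required probability is `1 - 6 < 0`, so the empty event suffices.
  · exact ⟨∅, MeasurableSet.empty, by simp, fun ω hω => absurd hω (Set.notMem_empty ω)⟩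
  have hpi := Real.pi_pos
  have hmM := StochReg.stabm_le_stabMk hX hfX hBX hm hp hk
  have hM1 := hm.trans_le (StochReg.stabm_le_stabMk hX hfX hBX hm hp le_rfl)
  have hMe := hε.stabM_nonneg hfε hBε
  set m := StochReg.stabm fX
  set M := StochReg.stabMk fX k
  have hM : 0 < M := hm.trans_le hmM
  have hn0 : (0 : ℝ) < n := by exact_mod_cast hn
  have hk1 : (1 : ℝ) ≤ k := by exact_mod_cast hk
  have hl : 0 < Real.log p := Real.log_pos (by exact_mod_cast hp2)
  have hratio : 1 ≤ (M / m) ^ 2 := one_le_pow₀ ((one_le_div hm).2 hmM)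
  have hkl : Real.log p ≤ k * Real.log p := le_mul_of_one_le_left hl.le hk1
  have hnl : 16 * Real.log p ≤ n := by nlinarith
  have hexp : 5 * k * Real.log p ≤ n * (m / M) ^ 2 / 278784 := by
    have h1 : (m / M) ^ 2 * (M / m) ^ 2 = 1 := by field_simp
    have h2 := mul_le_mul_of_nonneg_left hC (sq_nonneg (m / M))
    rw [le_div_iff₀ (by norm_num)]
    calc 5 * k * Real.log p * 278784
        = 1393920 * (k * Real.log p) * ((m / M) ^ 2 * (M / m) ^ 2) := by rw [h1]; ring
      _ ≤ n * (m / M) ^ 2 := by linarith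
  -- Chosen so that `n u² / 16 = 4 log p`, which beats the union over `p` coordinates.
  set u := 8 * Real.sqrt (Real.log p / n) with hu
  have hu0 : 0 < u := by positivity
  have husq : u ^ 2 = 64 * (Real.log p / n) := by
    rw [hu, mul_pow, Real.sq_sqrt (by positivity)]; norm_num
  have hu2 : u ≤ 2 := by
    have : Real.log p / n ≤ 1 / 16 := by rw [div_le_iff₀ hn0]; linarith
    nlinarith
  have hlamu : 2 * Real.pi * (StochReg.stabMk fX 1 + StochReg.stabM fε) * u * 2 ≤ lam := by
    refine le_trans (le_of_eq ?_) hlam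
    rw [hu]; ring
  have hlam0 : 0 < lam := lt_of_lt_of_le (by positivity) hlamu
  let G := StochReg.autocov X μ 0
  let A : (Fin (2 * k) → Fin p × Bool) → Set Ω := fun J =>
    {ω | StochReg.sqNorm ((StochReg.dataMatrix n X ω).mulVec (∑ i, StochReg.signedBasis (J i))) <
      n * (∑ i, ∑ j, (∑ i, StochReg.signedBasis (J i)) i * (∑ i, StochReg.signedBasis (J i)) j *
        G i j) - n * (Real.pi * m / 33 * ∑ j, (∑ i, StochReg.signedBasis (J i)) j ^ 2)}
  let D : Fin p → Set Ω := fun j =>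
    {ω | n * G j j + n * (Real.pi * m / 33) <
      StochReg.sqNorm ((StochReg.dataMatrix n X ω).mulVec (Pi.single j 1))}
  let E : Fin p → Set Ω := fun j =>
    {ω | n * (2 * Real.pi * (StochReg.stabMk fX 1 + StochReg.stabM fε) * u) / 2 <
      |∑ r, StochReg.dataMatrix n X ω r j * ε ((n : ℤ) - (r : ℕ)) ω|}
  have hbad := StochReg.measureReal_iUnion_union_le (μ := μ) hp2 hk A D E
    (fun J => (StochReg.measure_sparse_lower_le hX hfX hBX hm hM _
      (StochReg.card_support_sum_signedBasis_le J)).trans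
      (Real.exp_le_exp.2 (neg_le_neg hexp)))
    (fun j => (StochReg.measure_diag_upper_le hX hfX hBX hm hmM hk j).trans
      (Real.exp_le_exp.2 (neg_le_neg hexp)))
    (fun j => (StochReg.measure_noise_le hX hfX hBX hε hfε hBε hind hM1 hu0.le hu2 j).trans
      (le_of_eq (by
        rw [husq]
        congr 3
        field_simp
        norm_num)))
  set Bad := (⋃ J, A J) ∪ ((⋃ j, D j) ∪ ⋃ j, E j)
  -- A measurable hull has the same measure as `Bad`, so measurability of the bad events is never
  -- needed.
  have hmeas : MeasurableSet (toMeasurable μ Bad) := measurableSet_toMeasurable _ _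
  refine ⟨(toMeasurable μ Bad)ᶜ, hmeas.compl, ?_, ?_⟩
  · rw [probReal_compl_eq_one_sub hmeas, Measure.real, measure_toMeasurable]
    have : (μ Bad).toReal ≤ _ := hbad
    linarith
  intro ω hω βhat hsol
  have hω' : ω ∉ Bad := fun h => hω (subset_toMeasurable μ Bad h)
  simp only [Bad, A, D, E, Set.mem_union, Set.mem_iUnion, Set.mem_ofPred_eq, not_or, not_exists,
    not_lt] at hω'
  obtain ⟨hωA, hωD, hωE⟩ := hω'
  have hH := hfX.ae_isHermitian hX.autocov_neg
  refine StochReg.lasso_bounds _ _ _ (StochReg.dataVector_response βstar X ε ω) hlam0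
    (by positivity) hsupp (fun j => ?_) (fun v hv => ?_) hsol
  · rw [one_div, inv_mul_le_iff₀ hn0]
    refine (hωE j).trans ?_
    nlinarith
  · refine StochReg.restricted_eigenvalue hk _ G (fun v => ?_) (fun J => ?_) (fun j => ?_)
      (by positivity) v hv
    · have h1 := hX.le_variance_proj hfX (StochReg.ae_realForm_ge_stabm hH hm v) 0
      rw [hX.variance_proj] at h1
      linarith
    · rw [one_div, le_inv_mul_iff₀ hn0, mul_sub]
      exact hωA J
    · rw [one_div, inv_mul_le_iff₀ hn0, mul_add]
      exact hωD j
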